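/- Let $V$ be a finite-dimensional Euclidean vector space with inner product $\langle\cdot,\cdot\rangle$ and let $\mathfrak R\subset V$ be an irreducible reduced crystallographic root system spanning $V$, with simple roots $\alpha_1,\dots,\alpha_l$ and highest root $\alpha_{\max}$. Write $\alpha^\vee=2\alpha/\langle\alpha,\alpha\rangle$ for the co-root of a root $\alpha$, let $W$ be the Weyl group (generated by the reflections $x\mapsto x-\langle\alpha,x\rangle\alpha^\vee$, $\alpha\in\mathfrak R$), let $\Lambda=\mathbb Z[\alpha_1^\vee,\dots,\alpha_l^\vee]\subset V$ be the co-root lattice, and let $W^{\mathrm{aff}}=\Lambda\rtimes W$ be the affine Weyl group, consisting of the affine maps $x\mapsto\lambda+w(x)$ with $\lambda\in\Lambda$, $w\in W$. Let $$A=\{x\in V\mid \langle\alpha_i,x\rangle>0\ (i=1,\dots,l),\ \langle\alpha_{\max},x\rangle<1\}$$ be the open Weyl alcove, and for $w\in W^{\mathrm{aff}}$ put $V_w=(\mathrm{id}-w)(A)=\{x-w(x)\mid x\in A\}$. Let $X=\bigcup_{w\in W}V_w$, and let $W^{\mathrm{aff}}_{\mathrm{reg}}$ be the set of $w\in W^{\mathrm{aff}}$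 for which $\mathrm{id}-w\colon V\to V$ is invertible. Then: (a) The sets $\lambda+\operatorname{int}(\overline X)$, $\lambda\in\Lambda$, are pairwise disjoint, and $\bigcup_{\lambda\in\Lambda}(\lambda+\overline X)=V$. (b) The sets $V_w$, $w\in W^{\mathrm{aff}}_{\mathrm{reg}}$ (which are open polytopes), are pairwise disjoint, and $\bigcup_{w\in W^{\mathrm{aff}}_{\mathrm{reg}}}\overline{V}_w=V$. -/

import Mathlib

open scoped RealInnerProductSpace Pointwise

noncomputable section

namespace RootPairing

variable {ι V : Type*} [NormedAddCommGroup V] [InnerProductSpace ℝ V]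

/-- A root pairing is Euclidean if roots and co-roots live in the same Euclidean space `V`, which is
paired with itself by its inner product, and the co-root of a root `α` is `2 α / ⟪α, α⟫`. Thus the
reflections `x ↦ x - ⟪x, α^∨⟫ α` are the orthogonal reflections `x ↦ x - ⟪α, x⟫ α^∨`, and this is
a root system in the Euclidean space `V` in the classical sense. -/
class IsEuclidean (P : RootPairing ι ℝ V V) : Prop where
  toLinearMap_eq_inner : ∀ x y : V, P.toLinearMap x y = ⟪x, y⟫
  coroot_eq : ∀ i, P.coroot i = (2 / ⟪P.root i, P.root i⟫) • P.root i

/-- The root with index `θ` is the highest root with respect to the simple roots of `b`: for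
every root `β` the difference `α_θ - β` is a sum of simple roots. -/
def Base.IsHighestRoot {P : RootPairing ι ℝ V V} (b : P.Base) (θ : ι) : Prop :=
  ∀ j, P.root θ - P.root j ∈ AddSubmonoid.closure (P.root '' b.support)

/-- The open Weyl alcove, cut out of the open Weyl chamber of `b` by the highest root `θ`. -/
def Base.alcove {P : RootPairing ι ℝ V V} (b : P.Base) (θ : ι) : Set V :=
  {x | (∀ i ∈ b.support, 0 < ⟪P.root i, x⟫) ∧ ⟪P.root θ, x⟫ < 1}

/-- The set `V_w = (id - w)(A)` for a transformation `w` of `V`, where `A` is the open alcove. -/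
def Base.tile {P : RootPairing ι ℝ V V} (b : P.Base) (θ : ι) (w : V → V) : Set V :=
  (fun x => x - w x) '' b.alcove θ

/-- The set `X`, the union of the `V_w` over the elements `w` of the (finite) Weyl group, acting
linearly on `V`. -/
def Base.weylUnion {P : RootPairing ι ℝ V V} (b : P.Base) (θ : ι) : Set V :=
  ⋃ w : P.weylGroup, b.tile θ (fun x => w • x)

variable (P : RootPairing ι ℝ V V)

/-- The co-root lattice: the set of integral linear combinations of co-roots (equivalently of
simple co-roots, by `RootPairing.Base.span_int_coroot_support`). -/
def corootLattice : AddSubgroup V := (Submodule.span ℤ (Set.range P.coroot)).toAddSubgroup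

lemma inner_reflection_reflection [P.IsEuclidean] (i : ι) (x : V) :
    ⟪P.reflection i x, P.reflection i x⟫ = ⟪x, x⟫ := by
  have h0 : ⟪P.root i, P.root i⟫ ≠ 0 := by
    simpa using P.ne_zero i
  have h : P.reflection i x = x - (2 / ⟪P.root i, P.root i⟫ * ⟪x, P.root i⟫) • P.root i := by
    rw [RootPairing.reflection_apply, RootPairing.coroot', LinearMap.flip_apply,
      IsEuclidean.toLinearMap_eq_inner, IsEuclidean.coroot_eq, inner_smul_right]
  rw [h]
  simp only [inner_sub_left, inner_sub_right, inner_smul_left, inner_smul_right,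
    real_inner_comm x (P.root i), conj_trivial]
  field_simp
  ring

lemma weylGroup_smul_coroot_mem [P.IsEuclidean] (w : P.weylGroup) (i : ι) :
    w • P.coroot i ∈ Set.range P.coroot := by
  have hn : ∀ x : V, ⟪w • x, w • x⟫ = ⟪x, x⟫ := by
    obtain ⟨w, hw⟩ := w
    induction hw using weylGroup.induction with
    | mem j => exact fun x => P.inner_reflection_reflection j x
    | one => simp
    | mul g₁ g₂ hg₁ hg₂ h₁ h₂ =>
      intro x
      rw [← Submonoid.mk_mul_mk _ _ _ hg₁ hg₂, mul_smul, h₁, h₂]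
  refine ⟨P.weylGroupToPerm w i, ?_⟩
  have hs : ∀ (c : ℝ) (x : V), w • c • x = c • w • x := fun c x =>
    map_smul (P.weylGroupRootRep w) c x
  rw [IsEuclidean.coroot_eq, IsEuclidean.coroot_eq, ← P.weylGroup_apply_root w i, hn, hs]

lemma weylGroup_smul_mem_corootLattice [P.IsEuclidean] (w : P.weylGroup) {v : V}
    (hv : v ∈ P.corootLattice) : w • v ∈ P.corootLattice := by
  change v ∈ Submodule.span ℤ (Set.range P.coroot) at hv
  change w • v ∈ Submodule.span ℤ (Set.range P.coroot)
  induction hv using Submodule.span_induction with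
  | mem x hx =>
    obtain ⟨i, rfl⟩ := hx
    exact Submodule.subset_span (P.weylGroup_smul_coroot_mem w i)
  | zero => simp
  | add x y _ _ hx hy => rw [smul_add]; exact add_mem hx hy
  | smul a x _ hx =>
    have : w • a • x = a • w • x := map_zsmul (DistribSMul.toAddMonoidHom V w) a x
    rw [this]
    exact Submodule.smul_mem _ _ hx

/-- The affine Weyl group `Λ ⋊ W`, as a group of affine transformations of `V`: its elements are the
maps `x ↦ v + w x` with `v` in the co-root lattice and `w` in the Weyl group. -/
def affineWeylGroup [P.IsEuclidean] : Subgroup (V ≃ᵃ[ℝ] V) where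
  carrier := {g | ∃ v ∈ P.corootLattice, ∃ w : P.weylGroup, ∀ x, g x = v + w • x}
  mul_mem' := by
    rintro g h ⟨v, hv, w, hg⟩ ⟨v', hv', w', hh⟩
    refine ⟨v + w • v', add_mem hv (P.weylGroup_smul_mem_corootLattice w hv'), w * w', fun x => ?_⟩
    rw [AffineEquiv.coe_mul, Function.comp_apply, hg, hh, smul_add, mul_smul, add_assoc]
  one_mem' := ⟨0, zero_mem _, 1, fun x => by simp⟩
  inv_mem' := by
    rintro g ⟨v, hv, w, hg⟩
    refine ⟨-(w⁻¹ • v), neg_mem (P.weylGroup_smul_mem_corootLattice _ hv), w⁻¹, fun x => ?_⟩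
    apply g.injective
    have hgi : g (g⁻¹ x) = x := g.apply_symm_apply x
    rw [hgi, hg, smul_add, smul_neg, smul_inv_smul, smul_inv_smul, add_neg_cancel_left]

/-- The set of those elements `w` of the affine Weyl group for which `id - w` is invertible. -/
def affineWeylReg [P.IsEuclidean] : Set (V ≃ᵃ[ℝ] V) :=
  {w | w ∈ P.affineWeylGroup ∧ Function.Bijective (fun x => x - w x)}

end RootPairing

end

open scoped RealInnerProductSpace Pointwise

noncomputable section

namespace RootPairing

/-! ### The Weyl group acting by isometries -/

section WeylGroup

variable {ι V : Type*} [NormedAddCommGroup V] [InnerProductSpace ℝ V]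
  (P : RootPairing ι ℝ V V)

/-! The tile of the affine map `x ↦ v + w • x` is the translate by `-v` of the tile of `w`. Both
parts thus concern the translates of the finitely many sets `V_w`, `w ∈ W`, by the co-root lattice
`Λ`. The argument shows that the closed tiles cover `V`, and then that their volumes leave no room
for overlaps.

Covering (`exists_eq_sub_add_smul`): folding sends a point of `V` to a point of its `W^aff`-orbit in
the closed alcove. It does not increase distances, because two points of the closed alcove are at
least as close as any other pair from their orbits (`norm_sub_le_of_mem_closedAlcove`). Translating
by `-y` and folding back is therefore a nonexpansive self-map of a compact convex set. It has a
fixed point `a`, and this means `y = a - g a` for some `g ∈ W^aff`.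

Volume: `V_w` has volume `det (1 - w) * vol A`. These determinants are nonnegative since `w` is an
isometry, and they sum to `|W|` over `W`, because averaging over `W` kills alternating forms of
positive degree (`sum_det_one_sub_weylLinear`). So the tiles have total volume `|W| * vol A`, the
volume of the fundamental domain `⋃ w, w A` of `Λ`. A cover with exactly this volume overlaps only
in null sets (`measure_vadd_inter_vadd_eq_zero`).

Open sets that meet in a null set are disjoint; this gives both disjointness claims. Singular `w`
contribute null tiles. The regular closed tiles form a closed set whose complement is open and null,
so they already cover `V`. -/

lemma inner_coroot [P.IsEuclidean] (i : ι) (x : V) :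
    ⟪P.coroot i, x⟫ = 2 * ⟪P.root i, x⟫ / ⟪P.root i, P.root i⟫ := by
  rw [IsEuclidean.coroot_eq, real_inner_smul_left]
  ring

lemma inner_root_self_pos (i : ι) : 0 < ⟪P.root i, P.root i⟫ :=
  real_inner_self_pos.2 (P.ne_zero i)

lemma reflection_eq_sub_inner_smul_coroot [P.IsEuclidean] (i : ι) (x : V) :
    P.reflection i x = x - ⟪P.root i, x⟫ • P.coroot i := by
  rw [RootPairing.reflection_apply, RootPairing.coroot', LinearMap.flip_apply,
    IsEuclidean.toLinearMap_eq_inner, IsEuclidean.coroot_eq, inner_smul_right, smul_smul,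
    real_inner_comm x, mul_comm]

lemma weylGroup_ofIdx_smul_eq [P.IsEuclidean] (i : ι) (x : V) :
    weylGroup.ofIdx P i • x = x - ⟪P.root i, x⟫ • P.coroot i :=
  P.reflection_eq_sub_inner_smul_coroot i x

lemma inner_root_coroot [P.IsEuclidean] (i j : ι) : ⟪P.root i, P.coroot j⟫ = P.pairing i j := by
  rw [← root_coroot_eq_pairing, IsEuclidean.toLinearMap_eq_inner]

lemma inner_root_coroot_self [P.IsEuclidean] (i : ι) : ⟪P.root i, P.coroot i⟫ = 2 := by
  rw [inner_root_coroot, pairing_same]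

lemma weylGroup_smul_smul (w : P.weylGroup) (c : ℝ) (x : V) : w • c • x = c • w • x :=
  map_smul (P.weylGroupRootRep w) c x

/-- The action of an element of the Weyl group, as a linear automorphism. -/
def weylLinear (w : P.weylGroup) : V →ₗ[ℝ] V := P.weylGroupRootRep w

@[simp] lemma weylLinear_apply (w : P.weylGroup) (x : V) : P.weylLinear w x = w • x := rfl

lemma norm_weylGroup_smul [P.IsEuclidean] (w : P.weylGroup) (x : V) : ‖w • x‖ = ‖x‖ := by
  have hn : ∀ x : V, ⟪w • x, w • x⟫ = ⟪x, x⟫ := by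
    obtain ⟨w, hw⟩ := w
    induction hw using weylGroup.induction with
    | mem j => exact fun x => P.inner_reflection_reflection j x
    | one => simp
    | mul g₁ g₂ hg₁ hg₂ h₁ h₂ =>
      intro x
      rw [← Submonoid.mk_mul_mk _ _ _ hg₁ hg₂, mul_smul, h₁, h₂]
  rw [norm_eq_sqrt_real_inner, hn, ← norm_eq_sqrt_real_inner]

lemma inner_weylGroup_smul_smul [P.IsEuclidean] (w : P.weylGroup) (x y : V) :
    ⟪w • x, w • y⟫ = ⟪x, y⟫ := by
  rw [real_inner_eq_norm_add_mul_self_sub_norm_mul_self_sub_norm_mul_self_div_two, ← smul_add,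
    norm_weylGroup_smul, norm_weylGroup_smul, norm_weylGroup_smul,
    ← real_inner_eq_norm_add_mul_self_sub_norm_mul_self_sub_norm_mul_self_div_two]

lemma inner_weylGroup_smul_right [P.IsEuclidean] (w : P.weylGroup) (x y : V) :
    ⟪x, w • y⟫ = ⟪w⁻¹ • x, y⟫ := by
  rw [← P.inner_weylGroup_smul_smul w⁻¹, inv_smul_smul]

lemma continuous_weylGroup_smul [P.IsEuclidean] (w : P.weylGroup) :
    Continuous fun x : V => w • x := by
  refine (LipschitzWith.of_dist_le_mul (K := 1) fun x y => ?_).continuous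
  rw [dist_eq_norm, dist_eq_norm, ← smul_sub, norm_weylGroup_smul]
  simp

lemma weylGroup_eq_one_of_forall_smul_eq {w : P.weylGroup} (h : ∀ x : V, w • x = x) : w = 1 := by
  apply Subtype.ext
  apply Equiv.weightHom_injective P
  ext x
  simpa using! h x

lemma weylGroup_eq_of_forall_smul_eq {w w' : P.weylGroup} (h : ∀ x : V, w • x = w' • x) :
    w = w' := by
  rw [← inv_mul_eq_one]
  apply P.weylGroup_eq_one_of_forall_smul_eq
  intro x
  rw [mul_smul, ← h, inv_smul_smul]

lemma finite_weylGroup [Finite ι] [P.IsRootSystem] : Finite P.weylGroup := by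
  refine Finite.of_injective (P.weylGroupToPerm) fun w w' h => ?_
  apply P.weylGroup_eq_of_forall_smul_eq
  intro x
  have hx : x ∈ Submodule.span ℝ (Set.range P.root) := by
    rw [IsRootSystem.span_root_eq_top]; trivial
  induction hx using Submodule.span_induction with
  | mem x hx =>
    obtain ⟨i, rfl⟩ := hx
    rw [weylGroup_apply_root, weylGroup_apply_root, h]
  | zero => simp
  | add x y _ _ hx hy => rw [smul_add, smul_add, hx, hy]
  | smul a x _ hx => rw [weylGroup_smul_smul, weylGroup_smul_smul, hx]

lemma ofIdx_mul_self (i : ι) : weylGroup.ofIdx P i * weylGroup.ofIdx P i = 1 := by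
  apply P.weylGroup_eq_one_of_forall_smul_eq
  intro x
  rw [mul_smul]
  exact P.reflection_same i x

lemma weylGroup_smul_coroot [P.IsEuclidean] (w : P.weylGroup) (i : ι) :
    w • P.coroot i = P.coroot (P.weylGroupToPerm w i) := by
  rw [IsEuclidean.coroot_eq, IsEuclidean.coroot_eq, ← P.weylGroup_apply_root w i,
    inner_weylGroup_smul_smul, weylGroup_smul_smul]

lemma mul_ofIdx_eq_ofIdx_mul [P.IsEuclidean] (w : P.weylGroup) (i : ι) :
    w * weylGroup.ofIdx P i = weylGroup.ofIdx P (P.weylGroupToPerm w i) * w := by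
  apply P.weylGroup_eq_of_forall_smul_eq
  intro x
  rw [mul_smul, mul_smul, weylGroup_ofIdx_smul_eq, weylGroup_ofIdx_smul_eq, smul_sub,
    weylGroup_smul_smul, weylGroup_smul_coroot, ← weylGroup_apply_root, inner_weylGroup_smul_smul]

lemma exists_int_inner_root [P.IsEuclidean] [P.IsCrystallographic] (i : ι) {v : V}
    (hv : v ∈ P.corootLattice) : ∃ n : ℤ, ⟪P.root i, v⟫ = n := by
  change v ∈ Submodule.span ℤ (Set.range P.coroot) at hv
  induction hv using Submodule.span_induction with
  | mem x hx =>
    obtain ⟨j, rfl⟩ := hx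
    exact ⟨P.pairingIn ℤ i j, by rw [inner_root_coroot]; exact (P.algebraMap_pairingIn ℤ i j).symm⟩
  | zero => exact ⟨0, by simp⟩
  | add x y _ _ hx hy =>
    obtain ⟨m, hm⟩ := hx
    obtain ⟨n, hn⟩ := hy
    exact ⟨m + n, by rw [inner_add_right, hm, hn]; push_cast; rfl⟩
  | smul a x _ hx =>
    obtain ⟨m, hm⟩ := hx
    exact ⟨a * m, by rw [← Int.cast_smul_eq_zsmul ℝ, real_inner_smul_right, hm]; push_cast; rfl⟩

lemma coroot_mem_corootLattice (i : ι) : P.coroot i ∈ P.corootLattice :=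
  Submodule.subset_span (Set.mem_range_self i)

end WeylGroup

/-! ### The exchange property and simple transitivity on bases -/

namespace Base

variable {ι V : Type*} [NormedAddCommGroup V] [InnerProductSpace ℝ V]
  {P : RootPairing ι ℝ V V} (b : P.Base)

section

variable [Finite ι] [P.IsCrystallographic] [P.IsReduced]

/-- The exchange property: if a product of simple reflections makes a simple root `α_i` negative,
then multiplying the product by `s_i` amounts to deleting one of the factors. -/
lemma exists_prod_eq_prod_mul_ofIdx [P.IsEuclidean] {i : ι} (hi : i ∈ b.support)
    (L : List ι) (hL : ∀ j ∈ L, j ∈ b.support)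
    (h : ¬ b.IsPos (P.weylGroupToPerm (L.map (weylGroup.ofIdx P)).prod i)) :
    ∃ L' : List ι, (∀ j ∈ L', j ∈ b.support) ∧ L'.length + 1 = L.length ∧
      (L'.map (weylGroup.ofIdx P)).prod =
        (L.map (weylGroup.ofIdx P)).prod * weylGroup.ofIdx P i := by
  induction L with
  | nil => exact (h (by simpa using! isPos_of_mem_support hi)).elim
  | cons j L ih =>
    have hj : j ∈ b.support := hL j (by simp)
    have hL' : ∀ j ∈ L, j ∈ b.support := fun k hk => hL k (by simp [hk])
    by_cases hpos : b.IsPos (P.weylGroupToPerm (L.map (weylGroup.ofIdx P)).prod i)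
    · refine ⟨L, hL', by simp, ?_⟩
      -- `s_j` permutes the positive roots other than `α_j`, so a sign change at this factor forces
      -- the remaining product to send `α_i` to `α_j`. Conjugation then cancels `s_j`.
      have hk : P.weylGroupToPerm (L.map (weylGroup.ofIdx P)).prod i = j := by
        by_contra hne
        apply h
        have := hpos.reflectionPerm hj hne
        simpa using! this
      rw [List.map_cons, List.prod_cons, mul_assoc, mul_ofIdx_eq_ofIdx_mul, hk, ← mul_assoc,
        ofIdx_mul_self, one_mul]
    · obtain ⟨L', h1, h2, h3⟩ := ih hL' hpos
      refine ⟨j :: L', ?_, by simp [h2], ?_⟩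
      · intro k hk
        rcases List.mem_cons.1 hk with rfl | hk
        exacts [hj, h1 k hk]
      · rw [List.map_cons, List.prod_cons, h3, List.map_cons, List.prod_cons, mul_assoc]

lemma exists_list_prod_eq_ofIdx [P.IsEuclidean] (i : ι) :
    ∃ L : List ι, (∀ j ∈ L, j ∈ b.support) ∧
      (L.map (weylGroup.ofIdx P)).prod = weylGroup.ofIdx P i := by
  induction i using b.induction_reflect with
  | h₀ i ih =>
    obtain ⟨L, hL, h⟩ := ih
    refine ⟨L, hL, h.trans ?_⟩
    have := P.mul_ofIdx_eq_ofIdx_mul (weylGroup.ofIdx P i) i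
    exact mul_right_cancel this
  | h₁ i hi => exact ⟨[i], by simpa using hi, by simp⟩
  | h₂ i j ih hj =>
    obtain ⟨L, hL, h⟩ := ih
    refine ⟨j :: (L ++ [j]), by simpa [or_imp, forall_and, hj] using hL, ?_⟩
    have := P.mul_ofIdx_eq_ofIdx_mul (weylGroup.ofIdx P j) i
    simp only [List.map_cons, List.map_append, List.prod_cons, List.prod_append, h, List.map_nil,
      List.prod_nil, mul_one]
    rw [← mul_assoc, this, mul_assoc, ofIdx_mul_self, mul_one]
    rfl

lemma exists_list_prod_eq [P.IsEuclidean] (w : P.weylGroup) :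
    ∃ L : List ι, (∀ j ∈ L, j ∈ b.support) ∧ (L.map (weylGroup.ofIdx P)).prod = w := by
  obtain ⟨w, hw⟩ := w
  induction hw using weylGroup.induction with
  | mem i => exact b.exists_list_prod_eq_ofIdx i
  | one => exact ⟨[], by simp, rfl⟩
  | mul g₁ g₂ hg₁ hg₂ h₁ h₂ =>
    obtain ⟨L₁, h1, h1'⟩ := h₁
    obtain ⟨L₂, h2, h2'⟩ := h₂
    refine ⟨L₁ ++ L₂, by simpa [or_imp, forall_and] using ⟨h1, h2⟩, ?_⟩
    rw [List.map_append, List.prod_append, h1', h2']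
    rfl

/-- The Weyl group acts simply transitively on its bases: an element that preserves positivity of
the simple roots is trivial. -/
lemma eq_one_of_forall_isPos [P.IsEuclidean] {w : P.weylGroup}
    (h : ∀ i ∈ b.support, b.IsPos (P.weylGroupToPerm w i)) : w = 1 := by
  obtain ⟨L, hL, rfl⟩ := b.exists_list_prod_eq w
  induction hn : L.length using Nat.strong_induction_on generalizing L with
  | _ n ih =>
    subst hn
    rcases List.eq_nil_or_concat L with rfl | ⟨L, i, rfl⟩
    · rfl
    · have hi : i ∈ b.support := hL i (by simp)
      have hprod : ((L.concat i).map (weylGroup.ofIdx P)).prod =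
          (L.map (weylGroup.ofIdx P)).prod * weylGroup.ofIdx P i := by simp
      -- Since `s_i α_i = -α_i`, dropping the last letter turns the image of `α_i` negative.
      -- Exchange then shortens the word by two letters.
      have hneg : ¬ b.IsPos (P.weylGroupToPerm (L.map (weylGroup.ofIdx P)).prod i) := by
        let := P.indexNeg
        rw [← IsPos.neg_iff_not]
        convert h i hi using 1
        apply P.root.injective
        rw [hprod, ← weylGroup_apply_root, mul_smul, indexNeg_neg, root_reflectionPerm,
          reflection_apply_self, ← weylGroup_apply_root, weylGroup.ofIdx_smul,
          Equiv.reflection_smul, reflection_apply_self, smul_neg]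
      obtain ⟨L', h1, h2, h3⟩ := b.exists_prod_eq_prod_mul_ofIdx hi L
        (fun j hj => hL j (by simp [hj])) hneg
      rw [hprod, ← h3] at h ⊢
      refine ih L'.length ?_ L' h1 h rfl
      simp
      omega

end

end Base

end RootPairing

namespace RootPairing

/-! ### Discreteness of the co-root lattice and absence of minuscule elements -/

section Lattice

variable {ι V : Type*} [NormedAddCommGroup V] [InnerProductSpace ℝ V]
  (P : RootPairing ι ℝ V V)

lemma eq_zero_of_forall_inner_root_eq_zero [P.IsRootSystem] {x : V}
    (h : ∀ i, ⟪P.root i, x⟫ = 0) : x = 0 := by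
  have hx : x ∈ Submodule.span ℝ (Set.range P.root) := by
    rw [IsRootSystem.span_root_eq_top]; trivial
  have : ∀ y ∈ Submodule.span ℝ (Set.range P.root), ⟪y, x⟫ = 0 := by
    intro y hy
    induction hy using Submodule.span_induction with
    | mem y hy => obtain ⟨i, rfl⟩ := hy; exact h i
    | zero => simp
    | add y z _ _ hy hz => rw [inner_add_left, hy, hz, add_zero]
    | smul a y _ hy => rw [real_inner_smul_left, hy, mul_zero]
  exact inner_self_eq_zero.1 (this x hx)

/-- A lattice vector is determined by its pairings with the roots, which are integers bounded by
Cauchy–Schwarz. -/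
lemma finite_corootLattice_inter_norm_le [Finite ι] [P.IsRootSystem] [P.IsEuclidean]
    [P.IsCrystallographic] (R : ℝ) : {v : V | v ∈ P.corootLattice ∧ ‖v‖ ≤ R}.Finite := by
  have := Fintype.ofFinite ι
  obtain ⟨N, hN⟩ := exists_nat_ge (∑ i, ‖P.root i‖ * |R|)
  refine Set.Finite.of_injOn (f := fun v (i : ι) => ⟪P.root i, v⟫)
    (t := Set.univ.pi fun _ => ((↑) : ℤ → ℝ) '' Set.Icc (-N : ℤ) N) ?_ ?_
    (Set.Finite.pi fun _ => (Set.finite_Icc _ _).image _)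
  · rintro v ⟨hv, hvR⟩ i -
    obtain ⟨n, hn⟩ := P.exists_int_inner_root i hv
    refine ⟨n, ?_, hn.symm⟩
    have h1 : |(n : ℝ)| ≤ N := by
      rw [← hn]
      calc |⟪P.root i, v⟫| ≤ ‖P.root i‖ * ‖v‖ := abs_real_inner_le_norm _ _
        _ ≤ ‖P.root i‖ * |R| := by gcongr; exact hvR.trans (le_abs_self R)
        _ ≤ ∑ i, ‖P.root i‖ * |R| := Finset.single_le_sum
            (f := fun i => ‖P.root i‖ * |R|) (fun _ _ => by positivity) (Finset.mem_univ i)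
        _ ≤ N := hN
    rw [abs_le] at h1
    exact ⟨by exact_mod_cast h1.1, by exact_mod_cast h1.2⟩
  · intro v _ v' _ h
    rw [← sub_eq_zero]
    apply P.eq_zero_of_forall_inner_root_eq_zero
    intro i
    rw [inner_sub_right, sub_eq_zero]
    exact congrFun h i

lemma countable_corootLattice [Finite ι] [P.IsRootSystem] [P.IsEuclidean]
    [P.IsCrystallographic] : Countable P.corootLattice := by
  have : (P.corootLattice : Set V) = ⋃ n : ℕ, {v : V | v ∈ P.corootLattice ∧ ‖v‖ ≤ n} := by
    ext v
    simpa using fun _ => exists_nat_ge ‖v‖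
  have h : (P.corootLattice : Set V).Countable := by
    rw [this]
    exact Set.countable_iUnion fun n => (P.finite_corootLattice_inter_norm_le n).countable
  exact h.to_subtype

/-- Negatives of co-roots are co-roots, so no signs are needed. The length of the list serves as
induction parameter in `eq_zero_of_forall_inner_root_le_one`. -/
lemma exists_list_sum_coroot {v : V} (hv : v ∈ P.corootLattice) :
    ∃ L : List ι, v = (L.map P.coroot).sum := by
  change v ∈ Submodule.span ℤ (Set.range P.coroot) at hv
  rw [← Submodule.mem_toAddSubgroup, Submodule.span_int_eq_addSubgroupClosure] at hv
  induction hv using AddSubgroup.closure_induction with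
  | mem x hx => obtain ⟨i, rfl⟩ := hx; exact ⟨[i], by simp⟩
  | zero => exact ⟨[], by simp⟩
  | add x y _ _ hx hy =>
    obtain ⟨L, rfl⟩ := hx
    obtain ⟨L', rfl⟩ := hy
    exact ⟨L ++ L', by simp⟩
  | neg x _ hx =>
    obtain ⟨L, rfl⟩ := hx
    refine ⟨L.map fun i => P.reflectionPerm i i, ?_⟩
    clear * -
    induction L with
    | nil => simp
    | cons i L ih =>
      rw [List.map_cons, List.sum_cons, neg_add, ih,
        List.map_cons, List.map_cons, List.sum_cons, coroot_reflectionPerm,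
        coreflection_apply_self]

/-- The co-root lattice contains no nonzero minuscule co-weights. -/
lemma eq_zero_of_forall_inner_root_le_one [P.IsEuclidean] [P.IsCrystallographic] {v : V}
    (hv : v ∈ P.corootLattice) (h : ∀ i, ⟪P.root i, v⟫ ≤ 1) : v = 0 := by
  classical
  obtain ⟨L, hL⟩ := P.exists_list_sum_coroot hv
  induction hn : L.length generalizing L v with
  | zero =>
    rw [List.length_eq_zero_iff.1 hn] at hL
    simpa using hL
  | succ n ih =>
    by_contra hne
    -- Expanding `⟪v, v⟫ > 0` along the list, some summand pairs positively with `v`. Integrality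
    -- and the upper bound make the pairing with its root exactly `1`, so reflecting in that root
    -- deletes the summand and preserves the bound.
    obtain ⟨i, hi, hpos⟩ : ∃ i ∈ L, 0 < ⟪P.root i, v⟫ := by
      by_contra! hcon
      have hle : ∀ L' : List ι, (∀ i ∈ L', ⟪P.root i, v⟫ ≤ 0) →
          ⟪(L'.map P.coroot).sum, v⟫ ≤ 0 := by
        intro L' hL'
        induction L' with
        | nil => simp
        | cons i L' ih' =>
          rw [List.map_cons, List.sum_cons, inner_add_left, inner_coroot]
          have h1 := ih' fun j hj => hL' j (by simp [hj])
          have h2 : 2 * ⟪P.root i, v⟫ / ⟪P.root i, P.root i⟫ ≤ 0 :=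
            div_nonpos_of_nonpos_of_nonneg (by linarith [hL' i (by simp)])
              (P.inner_root_self_pos i).le
          linarith
      have h1 := hle L hcon
      rw [← hL] at h1
      exact hne (inner_self_eq_zero.1 (h1.antisymm real_inner_self_nonneg))
    obtain ⟨m, hm⟩ := P.exists_int_inner_root i hv
    have hm1 : ⟪P.root i, v⟫ = 1 := by
      have h1 := h i
      rw [hm] at h1 hpos ⊢
      have h1' : m ≤ 1 := by exact_mod_cast h1
      have h2' : 0 < m := by exact_mod_cast hpos
      exact_mod_cast (by omega : m = 1)
    have hs : weylGroup.ofIdx P i • v = v - P.coroot i := by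
      rw [weylGroup_ofIdx_smul_eq, hm1, one_smul]
    have h0 : weylGroup.ofIdx P i • v = 0 := by
      refine ih (P.weylGroup_smul_mem_corootLattice _ hv) (fun j => ?_) (L.erase i) ?_ ?_
      · rw [inner_weylGroup_smul_right, weylGroup_apply_root]
        exact h _
      · rw [hs, hL, ((List.perm_cons_erase hi).map P.coroot).sum_eq]
        simp
      · rw [List.length_erase_of_mem hi, hn]
        rfl
    exact hne ((smul_eq_zero_iff_eq _).1 h0)

end Lattice

/-! ### Convexity and compactness of the alcove -/

namespace Base

variable {ι V : Type*} [NormedAddCommGroup V] [InnerProductSpace ℝ V]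
  {P : RootPairing ι ℝ V V} (b : P.Base)

/-- The closed Weyl alcove. -/
def closedAlcove (θ : ι) : Set V :=
  {x | (∀ i ∈ b.support, 0 ≤ ⟪P.root i, x⟫) ∧ ⟪P.root θ, x⟫ ≤ 1}

variable {b} {θ : ι}

lemma alcove_subset_closedAlcove : b.alcove θ ⊆ b.closedAlcove θ :=
  fun _ hx => ⟨fun i hi => (hx.1 i hi).le, hx.2.le⟩

lemma isOpen_alcove : IsOpen (b.alcove θ) := by
  have : b.alcove θ = (⋂ i ∈ b.support, {x | 0 < ⟪P.root i, x⟫}) ∩ {x | ⟪P.root θ, x⟫ < 1} := by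
    ext x; simp [alcove]
  rw [this]
  refine IsOpen.inter (isOpen_biInter_finset fun i _ => ?_) ?_
  · exact isOpen_lt (by fun_prop) (by fun_prop)
  · exact isOpen_lt (by fun_prop) (by fun_prop)

lemma isClosed_closedAlcove : IsClosed (b.closedAlcove θ) := by
  have : b.closedAlcove θ =
      (⋂ i ∈ b.support, {x | 0 ≤ ⟪P.root i, x⟫}) ∩ {x | ⟪P.root θ, x⟫ ≤ 1} := by
    ext x; simp [closedAlcove]
  rw [this]
  refine IsClosed.inter (isClosed_biInter fun i _ => ?_) ?_
  · exact isClosed_le (by fun_prop) (by fun_prop)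
  · exact isClosed_le (by fun_prop) (by fun_prop)

lemma convex_closedAlcove : Convex ℝ (b.closedAlcove θ) := by
  intro x hx y hy s t hs ht hst
  refine ⟨fun i hi => ?_, ?_⟩
  · rw [inner_add_right, real_inner_smul_right, real_inner_smul_right]
    have := hx.1 i hi
    have := hy.1 i hi
    positivity
  · rw [inner_add_right, real_inner_smul_right, real_inner_smul_right]
    have := hx.2
    have := hy.2
    nlinarith

lemma openSegment_subset_alcove {a x : V} (ha : a ∈ b.alcove θ) (hx : x ∈ b.closedAlcove θ) :
    openSegment ℝ a x ⊆ b.alcove θ := by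
  rintro _ ⟨s, t, hs, ht, hst, rfl⟩
  refine ⟨fun i hi => ?_, ?_⟩
  · rw [inner_add_right, real_inner_smul_right, real_inner_smul_right]
    have := hx.1 i hi
    have := ha.1 i hi
    positivity
  · rw [inner_add_right, real_inner_smul_right, real_inner_smul_right]
    have := hx.2
    have := ha.2
    nlinarith

lemma convex_alcove : Convex ℝ (b.alcove θ) :=
  convex_iff_openSegment_subset.2 fun _ hx _ hy =>
    openSegment_subset_alcove hx (alcove_subset_closedAlcove hy)

lemma closure_alcove (h : (b.alcove θ).Nonempty) : closure (b.alcove θ) = b.closedAlcove θ := by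
  refine (closure_minimal alcove_subset_closedAlcove isClosed_closedAlcove).antisymm ?_
  intro x hx
  obtain ⟨a, ha⟩ := h
  have h1 := closure_mono (openSegment_subset_alcove ha hx)
  rw [closure_openSegment] at h1
  exact h1 (right_mem_segment ℝ a x)

lemma nonempty_alcove [FiniteDimensional ℝ V] [P.IsRootSystem] : (b.alcove θ).Nonempty := by
  let f : V →ₗ[ℝ] ℝ := b.toWeightBasis.constr ℝ fun _ => (1 : ℝ)
  let x : V := (InnerProductSpace.toDual ℝ V).symm (LinearMap.toContinuousLinearMap f)
  have hx : ∀ y, ⟪y, x⟫ = f y := by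
    intro y
    rw [real_inner_comm]
    simp [x]
  have hx1 : ∀ i ∈ b.support, ⟪P.root i, x⟫ = 1 := by
    intro i hi
    rw [hx]
    have := b.toWeightBasis.constr_basis ℝ (fun _ => (1 : ℝ)) ⟨i, hi⟩
    rwa [toWeightBasis_apply] at this
  have hc : 0 < (|⟪P.root θ, x⟫| + 1)⁻¹ := by positivity
  refine ⟨(|⟪P.root θ, x⟫| + 1)⁻¹ • x, fun i hi => ?_, ?_⟩
  · rw [real_inner_smul_right, hx1 i hi]
    linarith
  · rw [real_inner_smul_right, inv_mul_lt_one₀ (by positivity)]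
    linarith [le_abs_self ⟪P.root θ, x⟫]

lemma inner_root_le_inner_highest (hθ : b.IsHighestRoot θ) {x : V}
    (hx : ∀ i ∈ b.support, 0 ≤ ⟪P.root i, x⟫) (j : ι) : ⟪P.root j, x⟫ ≤ ⟪P.root θ, x⟫ := by
  have h : ∀ y ∈ AddSubmonoid.closure (P.root '' b.support), 0 ≤ ⟪y, x⟫ := by
    intro y hy
    induction hy using AddSubmonoid.closure_induction with
    | mem y hy => obtain ⟨i, hi, rfl⟩ := hy; exact hx i hi
    | zero => simp
    | add y z _ _ hy hz => rw [inner_add_left]; exact add_nonneg hy hz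
  have := h _ (hθ j)
  rw [inner_sub_left] at this
  linarith

lemma zero_mem_closedAlcove : (0 : V) ∈ b.closedAlcove θ := by
  simp [closedAlcove]

/-- The simple roots give injective, hence antilipschitz, linear coordinates. On the closed alcove
these lie in `[0, 1]`, since every root is dominated there by the highest one. -/
lemma isCompact_closedAlcove [FiniteDimensional ℝ V] [Finite ι] [P.IsRootSystem]
    (hθ : b.IsHighestRoot θ) : IsCompact (b.closedAlcove θ) := by
  have := Fintype.ofFinite ι
  let φ : V →ₗ[ℝ] (b.support → ℝ) := LinearMap.pi fun i => innerₗ V (P.root i)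
  have hφ : ∀ x i, φ x i = ⟪P.root i, x⟫ := fun x i => rfl
  have hker : LinearMap.ker φ = ⊥ := by
    rw [LinearMap.ker_eq_bot']
    intro x hx
    have hspan : x ∈ Submodule.span ℝ (P.root '' b.support) := by
      rw [b.span_root_support, RootPairing.rootSpan, IsRootSystem.span_root_eq_top]; trivial
    have : ∀ y ∈ Submodule.span ℝ (P.root '' b.support), ⟪y, x⟫ = 0 := by
      intro y hy
      induction hy using Submodule.span_induction with
      | mem y hy => obtain ⟨i, hi, rfl⟩ := hy; exact congrFun hx ⟨i, hi⟩
      | zero => simp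
      | add y z _ _ hy hz => rw [inner_add_left, hy, hz, add_zero]
      | smul a y _ hy => rw [real_inner_smul_left, hy, mul_zero]
    exact inner_self_eq_zero.1 (this x hspan)
  obtain ⟨K, -, hK⟩ := LinearMap.exists_antilipschitzWith φ hker
  refine Metric.isCompact_of_isClosed_isBounded isClosed_closedAlcove ?_
  refine (Metric.isBounded_closedBall (x := (0 : V)) (r := K)).subset fun x hx => ?_
  rw [Metric.mem_closedBall]
  refine (hK.le_mul_dist x 0).trans ?_
  have : dist (φ x) (φ 0) ≤ 1 := by
    rw [map_zero, dist_zero_right, pi_norm_le_iff_of_nonneg zero_le_one]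
    intro i
    rw [hφ, Real.norm_eq_abs, abs_of_nonneg (hx.1 i i.2)]
    exact (inner_root_le_inner_highest hθ hx.1 i).trans hx.2
  calc (K : ℝ) * dist (φ x) (φ 0) ≤ K * 1 := by gcongr
    _ = K := mul_one _

/-! ### Affine roots and simple transitivity on alcoves -/

section Positive

variable [Finite ι] [P.IsCrystallographic]

lemma inner_pos_of_isPos {x : V} (hx : ∀ i ∈ b.support, 0 < ⟪P.root i, x⟫) {j : ι}
    (hj : b.IsPos j) : 0 < ⟪P.root j, x⟫ := by
  refine hj.induction_on_add (p := fun j => 0 < ⟪P.root j, x⟫) hx fun i j k hk hi hj => ?_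
  rw [hk, inner_add_left]
  exact add_pos hi (hx j hj)

omit [Finite ι] [P.IsCrystallographic] in
lemma isPos_or_exists_isPos_neg (j : ι) :
    b.IsPos j ∨ ∃ k, b.IsPos k ∧ P.root k = - P.root j := by
  let := P.indexNeg
  rcases IsPos.or_neg b j with h | h
  · exact Or.inl h
  · exact Or.inr ⟨-j, h, by simp⟩

lemma isPos_of_inner_pos {x : V} (hx : ∀ i ∈ b.support, 0 < ⟪P.root i, x⟫) {j : ι}
    (hj : 0 < ⟪P.root j, x⟫) : b.IsPos j := by
  rcases b.isPos_or_exists_isPos_neg j with h | ⟨k, hk, hkj⟩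
  · exact h
  · have := inner_pos_of_isPos hx hk
    rw [hkj, inner_neg_left] at this
    linarith

lemma inner_root_mem_Ioo (hθ : b.IsHighestRoot θ) {x : V} (hx : x ∈ b.alcove θ) (j : ι) :
    (b.IsPos j ∧ 0 < ⟪P.root j, x⟫ ∧ ⟪P.root j, x⟫ < 1) ∨
      (¬ b.IsPos j ∧ -1 < ⟪P.root j, x⟫ ∧ ⟪P.root j, x⟫ < 0) := by
  have hle : ∀ k, ⟪P.root k, x⟫ < 1 := fun k =>
    (inner_root_le_inner_highest hθ (fun i hi => (hx.1 i hi).le) k).trans_lt hx.2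
  by_cases hj : b.IsPos j
  · exact Or.inl ⟨hj, inner_pos_of_isPos hx.1 hj, hle j⟩
  · rcases b.isPos_or_exists_isPos_neg j with h | ⟨k, hk, hkj⟩
    · exact (hj h).elim
    · have h1 := inner_pos_of_isPos hx.1 hk
      have h2 := hle k
      rw [hkj, inner_neg_left] at h1 h2
      exact Or.inr ⟨hj, by linarith, by linarith⟩

lemma inner_root_ne_int (hθ : b.IsHighestRoot θ) {x : V} (hx : x ∈ b.alcove θ) (j : ι) (n : ℤ) :
    ⟪P.root j, x⟫ ≠ n := by
  intro h
  rcases inner_root_mem_Ioo hθ hx j with ⟨-, h1, h2⟩ | ⟨-, h1, h2⟩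
  · rw [h] at h1 h2
    have h1' : 0 < n := by exact_mod_cast h1
    have h2' : n < 1 := by exact_mod_cast h2
    omega
  · rw [h] at h1 h2
    have h1' : -1 < n := by exact_mod_cast h1
    have h2' : n < 0 := by exact_mod_cast h2
    omega

/-- No affine root changes its sign on the alcove. -/
lemma add_inner_root_pos (hθ : b.IsHighestRoot θ) {a x : V} (ha : a ∈ b.alcove θ)
    (hx : x ∈ b.alcove θ) {j : ι} {n : ℤ} (h : 0 < n + ⟪P.root j, a⟫) :
    0 < n + ⟪P.root j, x⟫ := by
  -- On the alcove a positive root takes values in `(0, 1)` and any other root in `(-1, 0)`, so the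
  -- sign depends only on `n` and the positivity of `j`.
  rcases inner_root_mem_Ioo hθ ha j with ⟨hj, h1, h2⟩ | ⟨hj, h1, h2⟩ <;>
  rcases inner_root_mem_Ioo hθ hx j with ⟨hj', h3, h4⟩ | ⟨hj', h3, h4⟩
  · have : (-1 : ℝ) < n := by linarith
    have : -1 < n := by exact_mod_cast this
    have : (0 : ℝ) ≤ n := by exact_mod_cast (by omega : 0 ≤ n)
    linarith
  · exact (hj' hj).elim
  · exact (hj hj').elim
  · have : (0 : ℝ) < n := by linarith
    have : 0 < n := by exact_mod_cast this
    have : (1 : ℝ) ≤ n := by exact_mod_cast (by omega : 1 ≤ n)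
    linarith

variable [P.IsEuclidean]

/-- The inequalities defining the alcove pull back to sign conditions on affine roots, so a single
point decides for all. -/
lemma add_smul_mem_alcove (hθ : b.IsHighestRoot θ) {a x v : V} {w : P.weylGroup}
    (ha : a ∈ b.alcove θ) (hx : x ∈ b.alcove θ) (hv : v ∈ P.corootLattice)
    (h : v + w • a ∈ b.alcove θ) : v + w • x ∈ b.alcove θ := by
  refine ⟨fun i hi => ?_, ?_⟩
  · have h1 := h.1 i hi
    obtain ⟨n, hn⟩ := P.exists_int_inner_root i hv
    rw [inner_add_right, inner_weylGroup_smul_right, weylGroup_apply_root, hn] at h1 ⊢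
    exact add_inner_root_pos hθ ha hx h1
  · let := P.indexNeg
    have h1 := h.2
    obtain ⟨n, hn⟩ := P.exists_int_inner_root θ hv
    rw [inner_add_right, inner_weylGroup_smul_right, weylGroup_apply_root, hn] at h1 ⊢
    set j := P.weylGroupToPerm w⁻¹ θ
    have hj : ∀ y, ⟪P.root (-j), y⟫ = - ⟪P.root j, y⟫ := by simp
    have h2 : 0 < ((1 - n : ℤ) : ℝ) + ⟪P.root (-j), a⟫ := by
      rw [hj]; push_cast; linarith
    have h3 := add_inner_root_pos hθ ha hx h2
    rw [hj] at h3
    push_cast at h3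
    linarith

variable [FiniteDimensional ℝ V] [P.IsRootSystem] [P.IsReduced]

omit [FiniteDimensional ℝ V] [P.IsRootSystem] in
/-- The affine Weyl group acts simply transitively on the alcoves. -/
lemma eq_zero_and_eq_one_of_add_smul_mem_alcove (hθ : b.IsHighestRoot θ) {a v : V}
    {w : P.weylGroup} (ha : a ∈ b.alcove θ) (hv : v ∈ P.corootLattice)
    (h : v + w • a ∈ b.alcove θ) : v = 0 ∧ w = 1 := by
  have hmaps : Set.MapsTo (fun x => v + w • x) (b.alcove θ) (b.alcove θ) :=
    fun x hx => add_smul_mem_alcove hθ ha hx hv h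
  -- Passing to the closure allows evaluation at `0`: its image `v` lies in the closed alcove, where
  -- all roots are at most `1`.
  have hcl := hmaps.closure (continuous_const.add (P.continuous_weylGroup_smul w))
  rw [closure_alcove ⟨a, ha⟩] at hcl
  have hv1 : v ∈ b.closedAlcove θ := by
    simpa using hcl (zero_mem_closedAlcove (b := b) (θ := θ))
  have hv0 : v = 0 := P.eq_zero_of_forall_inner_root_le_one hv fun i =>
    (inner_root_le_inner_highest hθ hv1.1 i).trans hv1.2
  refine ⟨hv0, b.eq_one_of_forall_isPos fun i hi => ?_⟩
  subst hv0
  rw [zero_add] at h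
  apply isPos_of_inner_pos h.1
  rw [← weylGroup_apply_root, inner_weylGroup_smul_smul]
  exact ha.1 i hi

end Positive

end Base

/-! ### Folding into the closed alcove by minimizing distance -/

section Folding

variable {ι V : Type*} [NormedAddCommGroup V] [InnerProductSpace ℝ V]
  (P : RootPairing ι ℝ V V) [P.IsEuclidean]

/-- The sign of the extra term tells whether `a` and `p` lie on the same side of the mirror;
reflecting a point on the wrong side brings it closer to `a`. -/
lemma norm_sub_affine_reflection_sq (i : ι) (k : ℝ) (a p : V) :
    ‖a - (p - (⟪P.root i, p⟫ - k) • P.coroot i)‖ ^ 2 = ‖a - p‖ ^ 2 +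
      4 / ⟪P.root i, P.root i⟫ * ((⟪P.root i, p⟫ - k) * (⟪P.root i, a⟫ - k)) := by
  have h0 := (P.inner_root_self_pos i).ne'
  rw [← sub_add, norm_add_sq_real, real_inner_smul_right, real_inner_comm (P.coroot i), inner_coroot,
    ← real_inner_self_eq_norm_sq ((_ : ℝ) • P.coroot i), real_inner_smul_left,
    real_inner_smul_right, inner_coroot, inner_root_coroot_self, inner_sub_right]
  field_simp
  ring

lemma exists_minimal_norm_sub [Finite ι] [P.IsRootSystem] [P.IsCrystallographic] (a y : V) :
    ∃ v ∈ P.corootLattice, ∃ w : P.weylGroup, ∀ v' ∈ P.corootLattice, ∀ w' : P.weylGroup,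
      ‖a - (v + w • y)‖ ≤ ‖a - (v' + w' • y)‖ := by
  have := P.finite_weylGroup
  let D : V × P.weylGroup → ℝ := fun p => ‖a - (p.1 + p.2 • y)‖
  let S : Set (V × P.weylGroup) := {p | p.1 ∈ P.corootLattice ∧ D p ≤ D (0, 1)}
  have hS : S.Finite := by
    refine ((P.finite_corootLattice_inter_norm_le (D (0, 1) + ‖a‖ + ‖y‖)).prod
      (Set.finite_univ (α := P.weylGroup))).subset ?_
    rintro ⟨v, w⟩ ⟨hv, hD⟩
    refine ⟨⟨hv, ?_⟩, trivial⟩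
    have : v = - (a - (v + w • y)) + a - w • y := by abel
    calc ‖v‖ = ‖- (a - (v + w • y)) + a - w • y‖ := by rw [← this]
      _ ≤ ‖- (a - (v + w • y)) + a‖ + ‖w • y‖ := norm_sub_le _ _
      _ ≤ ‖a - (v + w • y)‖ + ‖a‖ + ‖y‖ := by
        rw [P.norm_weylGroup_smul]
        gcongr
        exact (norm_add_le _ _).trans_eq (by rw [norm_neg])
      _ ≤ _ := by gcongr
  obtain ⟨⟨v, w⟩, ⟨hv, hle⟩, hmin⟩ := Set.exists_min_image S D hS
    ⟨(0, 1), zero_mem P.corootLattice, le_rfl⟩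
  refine ⟨v, hv, w, fun v' hv' w' => ?_⟩
  by_cases h : D (v', w') ≤ D (0, 1)
  · exact hmin (v', w') ⟨hv', h⟩
  · exact hle.trans (not_le.1 h).le

namespace Base

variable {P} {b : P.Base} {θ : ι} [Finite ι] [P.IsRootSystem] [P.IsCrystallographic]

omit [Finite ι] [P.IsRootSystem] [P.IsCrystallographic] in
/-- The points of an orbit of the affine Weyl group closest to a point of the alcove lie in the
closed alcove. -/
lemma mem_closedAlcove_of_forall_norm_sub_le {a y v : V} {w : P.weylGroup} (ha : a ∈ b.alcove θ)
    (hv : v ∈ P.corootLattice) (hmin : ∀ v' ∈ P.corootLattice, ∀ w' : P.weylGroup,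
      ‖a - (v + w • y)‖ ≤ ‖a - (v' + w' • y)‖) : v + w • y ∈ b.closedAlcove θ := by
  set p := v + w • y with hp
  have key : ∀ (i : ι) (k : ℤ), 0 ≤ (⟪P.root i, p⟫ - k) * (⟪P.root i, a⟫ - k) := by
    intro i k
    -- The competitor is the reflection of `p` in the hyperplane where the root takes the value `k`.
    -- It stays in the orbit because `k` is an integer.
    have h1 := hmin (weylGroup.ofIdx P i • v + k • P.coroot i)
      (add_mem (P.weylGroup_smul_mem_corootLattice _ hv)
        (zsmul_mem (P.coroot_mem_corootLattice i) k)) (weylGroup.ofIdx P i * w)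
    have h2 : weylGroup.ofIdx P i • v + k • P.coroot i + (weylGroup.ofIdx P i * w) • y =
        p - (⟪P.root i, p⟫ - k) • P.coroot i := by
      rw [mul_smul, add_right_comm, ← smul_add, ← hp, weylGroup_ofIdx_smul_eq, sub_smul,
        Int.cast_smul_eq_zsmul]
      abel
    rw [h2] at h1
    have h3 := pow_le_pow_left₀ (norm_nonneg _) h1 2
    rw [norm_sub_affine_reflection_sq] at h3
    have h4 := P.inner_root_self_pos i
    have h5 : 0 < 4 / ⟪P.root i, P.root i⟫ := by positivity
    exact nonneg_of_mul_nonneg_right (by linarith) h5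
  refine ⟨fun i hi => ?_, ?_⟩
  · have h1 := key i 0
    simp only [Int.cast_zero, sub_zero] at h1
    exact nonneg_of_mul_nonneg_left h1 (ha.1 i hi)
  · have h1 := key θ 1
    have h2 := ha.2
    push_cast at h1
    by_contra! hcon
    nlinarith

lemma exists_add_smul_mem_closedAlcove [FiniteDimensional ℝ V] (b : P.Base) (θ : ι) (y : V) :
    ∃ v ∈ P.corootLattice, ∃ w : P.weylGroup, v + w • y ∈ b.closedAlcove θ := by
  obtain ⟨a, ha⟩ := nonempty_alcove (b := b) (θ := θ)
  obtain ⟨v, hv, w, h⟩ := P.exists_minimal_norm_sub a y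
  exact ⟨v, hv, w, mem_closedAlcove_of_forall_norm_sub_le ha hv h⟩

/-- An orbit point closest to `a` lies in the closed alcove. No root is integral at `y`, hence none
is at any orbit point, so the closest point is in the open alcove; simple transitivity identifies it
with `y`. -/
lemma norm_sub_le_of_mem_alcove [FiniteDimensional ℝ V] [P.IsReduced] (hθ : b.IsHighestRoot θ)
    {a y v : V} (ha : a ∈ b.alcove θ) (hy : y ∈ b.alcove θ) (hv : v ∈ P.corootLattice)
    (w : P.weylGroup) : ‖a - y‖ ≤ ‖a - (v + w • y)‖ := by
  obtain ⟨v', hv', w', h⟩ := P.exists_minimal_norm_sub a y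
  have hcl := mem_closedAlcove_of_forall_norm_sub_le ha hv' h
  have hne : ∀ (i : ι) (n : ℤ), ⟪P.root i, v' + w' • y⟫ ≠ n := by
    intro i n hn
    obtain ⟨m, hm⟩ := P.exists_int_inner_root i hv'
    rw [inner_add_right, inner_weylGroup_smul_right, weylGroup_apply_root, hm] at hn
    apply inner_root_ne_int hθ hy (P.weylGroupToPerm w'⁻¹ i) (n - m)
    push_cast
    linarith
  have hmem : v' + w' • y ∈ b.alcove θ := by
    refine ⟨fun i hi => (hcl.1 i hi).lt_of_ne fun h0 => hne i 0 ?_,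
      hcl.2.lt_of_ne fun h1 => hne θ 1 ?_⟩
    · rw [← h0, Int.cast_zero]
    · rw [h1, Int.cast_one]
  obtain ⟨rfl, rfl⟩ := eq_zero_and_eq_one_of_add_smul_mem_alcove hθ hy hv' hmem
  simpa using h v hv w

/-- Points of the closed alcove are closest to each other within their orbits under the affine
Weyl group. -/
lemma norm_sub_le_of_mem_closedAlcove [FiniteDimensional ℝ V] [P.IsReduced]
    (hθ : b.IsHighestRoot θ) {a y v : V} (ha : a ∈ b.closedAlcove θ) (hy : y ∈ b.closedAlcove θ)
    (hv : v ∈ P.corootLattice) (w : P.weylGroup) : ‖a - y‖ ≤ ‖a - (v + w • y)‖ := by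
  have hclosed : IsClosed {p : V × V | ‖p.1 - p.2‖ ≤ ‖p.1 - (v + w • p.2)‖} := by
    refine isClosed_le (by fun_prop) ?_
    exact (continuous_fst.sub (continuous_const.add
      ((P.continuous_weylGroup_smul w).comp continuous_snd))).norm
  have hsub : b.alcove θ ×ˢ b.alcove θ ⊆ {p : V × V | ‖p.1 - p.2‖ ≤ ‖p.1 - (v + w • p.2)‖} :=
    fun p hp => norm_sub_le_of_mem_alcove hθ hp.1 hp.2 hv w
  have h := closure_minimal hsub hclosed
  rw [closure_prod_eq, closure_alcove nonempty_alcove] at h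
  exact h (Set.mk_mem_prod ha hy)

end Base

end Folding

end RootPairing

/-! ### Fixed points of nonexpansive maps and the covering -/

open Filter Topology in
/-- A nonexpansive self-map of a compact convex set has a fixed point. -/
lemma exists_fixedPoint_of_nonexpansive {E : Type*} [NormedAddCommGroup E] [NormedSpace ℝ E]
    {K : Set E} (hK : IsCompact K) (hconv : Convex ℝ K) (hne : K.Nonempty) {f : E → E}
    (hmaps : Set.MapsTo f K K) (hf : ∀ x ∈ K, ∀ y ∈ K, ‖f x - f y‖ ≤ ‖x - y‖) :
    ∃ x ∈ K, f x = x := by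
  obtain ⟨p, hp⟩ := hne
  have hfc : ContinuousOn f K := by
    refine (LipschitzOnWith.of_dist_le_mul (K := 1) fun x hx y hy => ?_).continuousOn
    rw [dist_eq_norm, dist_eq_norm, NNReal.coe_one, one_mul]
    exact hf x hx y hy
  obtain ⟨a, ha, hmin⟩ := hK.exists_isMinOn ⟨p, hp⟩ (continuousOn_id.sub hfc).norm
  -- Mixing `f` with the constant map `p` gives a `t`-contraction, whose fixed point is displaced by
  -- `f` by at most `(1 - t) * diam K`. The minimal displacement is then zero as `t → 1`.
  have hbound : ∀ t : ℝ, 0 < t → t < 1 → ‖a - f a‖ ≤ (1 - t) * Metric.diam K := by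
    intro t ht0 ht1
    let g : E → E := fun x => (1 - t) • p + t • f x
    have hg : Set.MapsTo g K K := fun x hx =>
      hconv hp (hmaps hx) (by linarith) ht0.le (by ring)
    have hcontr : ContractingWith ⟨t, ht0.le⟩ (hg.restrict g K K) := by
      refine ⟨by exact_mod_cast ht1, LipschitzWith.of_dist_le_mul fun x y => ?_⟩
      rw [Subtype.dist_eq, Subtype.dist_eq, dist_eq_norm, dist_eq_norm]
      have : g x - g y = t • (f x - f y) := by
        simp only [g]; rw [smul_sub]; abel
      change ‖g x - g y‖ ≤ t * _
      rw [this, norm_smul, Real.norm_of_nonneg ht0.le]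
      exact mul_le_mul_of_nonneg_left (hf x x.2 y y.2) ht0.le
    obtain ⟨x, hx, hfix, -⟩ := hcontr.exists_fixedPoint' hK.isComplete hg hp (edist_ne_top _ _)
    have hfix' : (1 - t) • p + t • f x = x := hfix
    have hx' : x - f x = (1 - t) • (p - f x) := by
      calc x - f x = (1 - t) • p + t • f x - f x := by rw [hfix']
        _ = (1 - t) • (p - f x) := by module
    calc ‖a - f a‖ ≤ ‖x - f x‖ := hmin hx
      _ = (1 - t) * ‖p - f x‖ := by
        rw [hx', norm_smul, Real.norm_of_nonneg (by linarith)]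
      _ ≤ (1 - t) * Metric.diam K := by
        refine mul_le_mul_of_nonneg_left ?_ (by linarith)
        rw [← dist_eq_norm]
        exact Metric.dist_le_diam_of_mem hK.isBounded hp (hmaps hx)
  have hlim : Tendsto (fun t : ℝ => (1 - t) * Metric.diam K) (𝓝[<] 1) (𝓝 0) := by
    have : Continuous fun t : ℝ => (1 - t) * Metric.diam K := by fun_prop
    simpa using (this.tendsto 1).mono_left nhdsWithin_le_nhds
  have hle : ‖a - f a‖ ≤ 0 := by
    refine ge_of_tendsto hlim ?_
    filter_upwards [Ioo_mem_nhdsLT (zero_lt_one' ℝ)] with t ht using hbound t ht.1 ht.2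
  exact ⟨a, ha, (sub_eq_zero.1 (norm_le_zero_iff.1 hle)).symm⟩

namespace RootPairing.Base

variable {ι V : Type*} [Finite ι] [NormedAddCommGroup V] [InnerProductSpace ℝ V]
  [FiniteDimensional ℝ V] {P : RootPairing ι ℝ V V} [P.IsRootSystem] [P.IsEuclidean]
  [P.IsCrystallographic] [P.IsReduced] {b : P.Base} {θ : ι}

/-- Every vector is of the form `a - g a` for a point `a` of the closed alcove and an element `g`
of the affine Weyl group: `a` is a fixed point of the translation by `-y` followed by folding
back to the closed alcove. -/
lemma exists_eq_sub_add_smul (hθ : b.IsHighestRoot θ) (y : V) :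
    ∃ a ∈ b.closedAlcove θ, ∃ v ∈ P.corootLattice, ∃ w : P.weylGroup, y = a - (v + w • a) := by
  choose v hv w h using exists_add_smul_mem_closedAlcove b θ
  obtain ⟨a, ha, hfix⟩ := exists_fixedPoint_of_nonexpansive (isCompact_closedAlcove hθ)
    convex_closedAlcove ⟨0, zero_mem_closedAlcove⟩
    (f := fun a => v (a - y) + w (a - y) • (a - y)) (fun a _ => h (a - y)) fun a _ c _ => by
      have hsub : w (a - y) • (a - c) = w (a - y) • (a - y) - w (a - y) • (c - y) := by
        rw [← smul_sub, sub_sub_sub_cancel_right]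
      -- Replace the folded `c - y` by its orbit point obtained by applying to `c - y` the element
      -- that folds `a - y`. This does not decrease the distance, and the new distance is `‖a - c‖`.
      calc ‖v (a - y) + w (a - y) • (a - y) - (v (c - y) + w (c - y) • (c - y))‖
          ≤ ‖v (a - y) + w (a - y) • (a - y) - ((v (a - y) - (w (a - y) * (w (c - y))⁻¹) •
              v (c - y)) + (w (a - y) * (w (c - y))⁻¹) • (v (c - y) + w (c - y) • (c - y)))‖ :=
            norm_sub_le_of_mem_closedAlcove hθ (h _) (h _)
              (sub_mem (hv _) (P.weylGroup_smul_mem_corootLattice _ (hv _))) _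
        _ = ‖w (a - y) • (a - c)‖ := by
            rw [smul_add, ← mul_smul, inv_mul_cancel_right, hsub]
            congr 1
            abel
        _ = ‖a - c‖ := P.norm_weylGroup_smul _ _
  refine ⟨a, ha, -((w (a - y))⁻¹ • v (a - y)),
    neg_mem (P.weylGroup_smul_mem_corootLattice _ (hv _)), (w (a - y))⁻¹, ?_⟩
  have h1 : w (a - y) • (a - y) = a - v (a - y) := eq_sub_of_add_eq' hfix
  have h2 : a - y = (w (a - y))⁻¹ • (a - v (a - y)) := by rw [← h1, inv_smul_smul]
  rw [neg_add_eq_sub, ← smul_sub, ← h2, sub_sub_cancel]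

end RootPairing.Base

/-! ### Determinants of `1 - w` and their average -/

/-- The effect on an alternating map of subtracting multiples of one vector from all vectors. -/
lemma AlternatingMap.map_sub_smul_apply {R M N n : Type*} [CommRing R] [AddCommGroup M]
    [Module R M] [AddCommGroup N] [Module R N] [Fintype n] [DecidableEq n]
    (f : M [⋀^n]→ₗ[R] N) (m : n → M) (d : n → R) (k : n) :
    f (fun i => m i - d i • m k) = (1 - d k) • f m := by
  -- Away from `k` the subtractions change nothing, one index at a time: each extra term repeats the
  -- argument `m k`.
  have hT : ∀ T : Finset n, k ∉ T →
      f (fun i => if i ∈ T then m i - d i • m k else m i) = f m := by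
    intro T
    induction T using Finset.induction_on with
    | empty => simp
    | insert j T hj ih =>
      intro hk
      rw [Finset.mem_insert, not_or] at hk
      have h1 : (fun i => if i ∈ insert j T then m i - d i • m k else m i) =
          Function.update (fun i => if i ∈ T then m i - d i • m k else m i) j
            (m j - d j • m k) := by
        ext i
        rcases eq_or_ne i j with rfl | hij
        · simp
        · simp [hij]
      have h2 := f.map_update_self (fun i => if i ∈ T then m i - d i • m k else m i) (Ne.symm hk.1)
      rw [if_neg hk.2] at h2
      rw [h1, f.map_update_sub, f.map_update_smul, h2, smul_zero, sub_zero, ← ih hk.2]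
      congr 1
      convert Function.update_eq_self j _ using 2
      rw [if_neg hj]
  have h1 : (fun i => m i - d i • m k) =
      Function.update (fun i => if i ∈ Finset.univ.erase k then m i - d i • m k else m i) k
        ((1 - d k) • m k) := by
    ext i
    rcases eq_or_ne i k with rfl | hik
    · simp [sub_smul]
    · simp [hik]
  rw [h1, f.map_update_smul, ← hT (Finset.univ.erase k) (Finset.notMem_erase _ _)]
  congr 2
  convert Function.update_eq_self k _ using 2
  simp

/-- The determinant of `id - L` is nonnegative for every isometry `L`. -/
lemma LinearMap.det_one_sub_nonneg_of_norm_map {V : Type*} [NormedAddCommGroup V]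
    [NormedSpace ℝ V] [FiniteDimensional ℝ V] (L : V →ₗ[ℝ] V) (hL : ∀ x, ‖L x‖ = ‖x‖) :
    0 ≤ LinearMap.det (1 - L) := by
  by_contra! hneg
  let B := Module.finBasis ℝ V
  have hcont : Continuous fun t : ℝ => LinearMap.det (1 - t • L) := by
    have : (fun t : ℝ => LinearMap.det (1 - t • L)) = fun t =>
        (1 - t • LinearMap.toMatrix B B L).det := by
      ext t
      rw [← LinearMap.det_toMatrix B, map_sub, map_smul, LinearMap.toMatrix_one]
    rw [this]
    exact Continuous.matrix_det (by fun_prop)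
  -- The determinant is `1` at `t = 0` and negative at `t = 1`. A zero in between yields `x = t • L
  -- x` with `x ≠ 0` and `t < 1`, which an isometry forbids.
  obtain ⟨t, ht, h0⟩ : (0 : ℝ) ∈ (fun t : ℝ => LinearMap.det (1 - t • L)) '' Set.Ioo 0 1 := by
    apply intermediate_value_Ioo' zero_le_one hcont.continuousOn
    simpa using hneg
  obtain ⟨x, hx, hx0⟩ := (Submodule.ne_bot_iff _).1 (LinearMap.bot_lt_ker_of_det_eq_zero h0).ne'
  have h1 : x = t • L x := sub_eq_zero.1 hx
  have h2 : ‖x‖ = t * ‖x‖ := by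
    conv_lhs => rw [h1, norm_smul, hL, Real.norm_of_nonneg ht.1.le]
  have h3 := norm_pos_iff.2 hx0
  nlinarith [ht.2]

namespace RootPairing

variable {ι V : Type*} [NormedAddCommGroup V] [InnerProductSpace ℝ V]
  (P : RootPairing ι ℝ V V) [P.IsRootSystem] [P.IsEuclidean] [Fintype P.weylGroup]

/-- There are no nonzero alternating forms invariant under the Weyl group: averages of alternating
forms (in a nonempty set of arguments) over the Weyl group vanish. -/
lemma sum_alternatingMap_piecewise_smul_eq_zero {n : Type*} [Fintype n] [DecidableEq n]
    (f : V [⋀^n]→ₗ[ℝ] ℝ) {s : Finset n} (hs : s.Nonempty) (u e : n → V) :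
    ∑ w : P.weylGroup, f (s.piecewise (fun i => w • u i) e) = 0 := by
  obtain ⟨k, hk⟩ := hs
  have hupd : ∀ (w : P.weylGroup) (x : V),
      s.piecewise (fun i => w • Function.update u k x i) e =
        Function.update (s.piecewise (fun i => w • u i) e) k (w • x) := by
    intro w x
    ext i
    rcases eq_or_ne i k with rfl | hik
    · simp [hk]
    · simp [hik, Finset.piecewise]
  suffices h : ∀ x ∈ Submodule.span ℝ (Set.range P.root),
      ∑ w : P.weylGroup, f (s.piecewise (fun i => w • Function.update u k x i) e) = 0 by
    have hx : u k ∈ Submodule.span ℝ (Set.range P.root) := by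
      rw [IsRootSystem.span_root_eq_top]; trivial
    simpa using h _ hx
  intro x hx
  induction hx using Submodule.span_induction with
  | mem x hx =>
    obtain ⟨j, rfl⟩ := hx
    set u' := Function.update u k (P.root j) with hu'
    have hu'k : u' k = P.root j := Function.update_self ..
    -- `s_j` subtracts a multiple of `u' k = α_j` from every argument indexed by `s`, with
    -- coefficient `2` at `k`, so the form is scaled by `1 - 2 = -1`. Reindexing by right
    -- multiplication makes the sum its own negative.
    have hterm : ∀ w : P.weylGroup,
        f (s.piecewise (fun i => (w * weylGroup.ofIdx P j) • u' i) e) =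
          - f (s.piecewise (fun i => w • u' i) e) := by
      intro w
      let d : n → ℝ := fun i =>
        if i ∈ s then ⟪P.root j, u' i⟫ * (2 / ⟪P.root j, P.root j⟫) else 0
      have h1 : s.piecewise (fun i => (w * weylGroup.ofIdx P j) • u' i) e =
          fun i => s.piecewise (fun i => w • u' i) e i -
            d i • s.piecewise (fun i => w • u' i) e k := by
        ext i
        by_cases hi : i ∈ s
        · simp only [Finset.piecewise_eq_of_mem _ _ _ hi, Finset.piecewise_eq_of_mem _ _ _ hk, d,
            if_pos hi, hu'k]
          rw [mul_smul, weylGroup_ofIdx_smul_eq, smul_sub, IsEuclidean.coroot_eq, smul_smul,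
            weylGroup_smul_smul]
        · simp [hi, d]
      have hdk : d k = 2 := by
        simp only [d, if_pos hk, hu'k]
        exact mul_div_cancel₀ _ (P.inner_root_self_pos j).ne'
      rw [h1, AlternatingMap.map_sub_smul_apply, hdk, smul_eq_mul]
      ring
    have h2 := _root_.Equiv.sum_comp (_root_.Equiv.mulRight (weylGroup.ofIdx P j))
      fun w : P.weylGroup => f (s.piecewise (fun i => w • u' i) e)
    simp only [_root_.Equiv.coe_mulRight, hterm, Finset.sum_neg_distrib] at h2
    linarith
  | zero =>
    refine Finset.sum_eq_zero fun w _ => ?_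
    rw [hupd, smul_zero]
    exact f.map_coord_zero k (Function.update_self ..)
  | add x y _ _ hx hy =>
    simp only [hupd, smul_add, f.map_update_add, Finset.sum_add_distrib] at hx hy ⊢
    rw [hx, hy, add_zero]
  | smul a x _ hx =>
    simp only [hupd, weylGroup_smul_smul, f.map_update_smul, ← Finset.smul_sum] at hx ⊢
    rw [hx, smul_zero]

/-- The determinants of `id - w`, for `w` in the Weyl group, are equal to `1` on average. -/
lemma sum_det_one_sub_weylLinear [FiniteDimensional ℝ V] :
    ∑ w : P.weylGroup, LinearMap.det (1 - P.weylLinear w) = (Fintype.card P.weylGroup : ℝ) := by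
  let B := Module.finBasis ℝ V
  have h1 : ∀ w : P.weylGroup, LinearMap.det (1 - P.weylLinear w) =
      ∑ s : Finset (Fin (Module.finrank ℝ V)), B.det (s.piecewise (fun i => w • - B i) B) := by
    intro w
    have h := B.det_comp (1 - P.weylLinear w) B
    rw [B.det_self, mul_one] at h
    rw [← h, ← AlternatingMap.coe_multilinearMap, ← MultilinearMap.map_add_univ]
    congr 1
    ext i
    simp [sub_eq_neg_add]
  simp only [h1]
  -- In the multilinear expansion every nonempty `s` averages to zero; the empty one contributes `1`
  -- for each `w`.
  rw [Finset.sum_comm, Finset.sum_eq_single ∅]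
  · simp [B.det_self]
  · intro s _ hs
    exact P.sum_alternatingMap_piecewise_smul_eq_zero B.det (Finset.nonempty_iff_ne_empty.2 hs) _ _
  · simp

end RootPairing

/-! ### Tilings by volume comparison -/

open MeasureTheory in
/-- If the translates of a finite family of sets cover the space, and if their total measure is at
most that of a fundamental domain, then all translates are almost everywhere disjoint. -/
lemma MeasureTheory.IsAddFundamentalDomain.measure_vadd_inter_vadd_eq_zero {Γ α κ : Type*}
    [AddGroup Γ] [Countable Γ] [AddAction Γ α] [MeasurableSpace α] {μ : Measure α}
    [MeasurableConstVAdd Γ α] [VAddInvariantMeasure Γ α μ] {F : Set α}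
    (hF : IsAddFundamentalDomain Γ F μ) [Fintype κ] {T : κ → Set α}
    (hT : ∀ k, NullMeasurableSet (T k) μ) (hcover : ∀ᵐ x ∂μ, ∃ g : Γ, ∃ k, x ∈ g +ᵥ T k)
    (hle : ∑ k, μ (T k) ≤ μ F) (hfin : μ F ≠ ⊤) {p q : Γ × κ} (hpq : p ≠ q) :
    μ ((p.1 +ᵥ T p.2) ∩ (q.1 +ᵥ T q.2)) = 0 := by
  classical
  -- `N` counts the translates through `x`. It is at least `1` almost everywhere by the covering,
  -- and its integral over `F` is at most `μ F`, so it equals `1` almost everywhere on `F`.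
  let N : α → ENNReal := fun x => ∑' p : Γ × κ, (p.1 +ᵥ T p.2).indicator 1 x
  have hTn : ∀ p : Γ × κ, NullMeasurableSet (p.1 +ᵥ T p.2) (μ.restrict F) := fun p =>
    ((hT p.2).vadd p.1).mono_ac Measure.restrict_le_self.absolutelyContinuous
  have hNm : ∀ p : Γ × κ, AEMeasurable ((p.1 +ᵥ T p.2).indicator (1 : α → ENNReal))
      (μ.restrict F) := fun p => aemeasurable_one.indicator₀ (hTn p)
  have hNint : ∫⁻ x in F, N x ∂μ = ∑ k, μ (T k) := by
    rw [lintegral_tsum hNm]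
    have h1 : ∀ p : Γ × κ, ∫⁻ x in F, (p.1 +ᵥ T p.2).indicator 1 x ∂μ =
        μ ((p.1 +ᵥ T p.2) ∩ F) := by
      intro p
      rw [lintegral_indicator_one₀ (hTn p),
        Measure.restrict_apply₀ (hTn p)]
    simp only [h1]
    rw [ENNReal.tsum_prod', ENNReal.tsum_comm, tsum_fintype]
    exact Finset.sum_congr rfl fun k _ => (hF.measure_eq_tsum (T k)).symm
  have hN1 : (fun _ => 1) ≤ᵐ[μ.restrict F] N := by
    filter_upwards [ae_restrict_of_ae hcover] with x hx
    obtain ⟨g, k, hx⟩ := hx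
    refine le_trans ?_ (ENNReal.le_tsum (g, k))
    rw [Set.indicator_of_mem hx, Pi.one_apply]
  have hNeq : (fun _ => 1) =ᵐ[μ.restrict F] N := by
    refine ae_eq_of_ae_le_of_lintegral_le hN1 ?_ ?_ ?_
    · simpa using hfin
    · exact AEMeasurable.tsum hNm
    · rw [hNint]
      simpa using hle
  have hnull : ∀ p q : Γ × κ, p ≠ q → μ (((p.1 +ᵥ T p.2) ∩ (q.1 +ᵥ T q.2)) ∩ F) = 0 := by
    intro p q hpq
    rw [← Measure.restrict_apply₀ ((hTn p).inter (hTn q))]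
    refine measure_mono_null (fun x hx => ?_) (ae_iff.1 hNeq)
    have h2 : (2 : ENNReal) ≤ N x := by
      refine le_trans ?_ (ENNReal.sum_le_tsum {p, q})
      rw [Finset.sum_pair hpq, Set.indicator_of_mem hx.1, Set.indicator_of_mem hx.2,
        Pi.one_apply, one_add_one_eq_two]
    intro h
    rw [← h] at h2
    exact absurd h2 (by norm_num)
  rw [hF.measure_eq_tsum]
  simp only [ENNReal.tsum_eq_zero]
  intro g
  rw [Set.vadd_set_inter, vadd_vadd, vadd_vadd]
  refine hnull (g + p.1, p.2) (g + q.1, q.2) fun h => hpq ?_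
  rw [Prod.mk.injEq] at h
  exact Prod.ext (add_left_cancel h.1) h.2

lemma LinearMap.bijective_iff_det_ne_zero {K V : Type*} [Field K] [AddCommGroup V] [Module K V]
    [FiniteDimensional K V] (f : V →ₗ[K] V) :
    Function.Bijective f ↔ LinearMap.det f ≠ 0 := by
  rw [← Module.End.isUnit_iff, LinearMap.isUnit_iff_isUnit_det, isUnit_iff_ne_zero]

/-! ### Volumes of the tiles and almost everywhere disjointness -/

namespace RootPairing

variable {ι V : Type*} [NormedAddCommGroup V] [InnerProductSpace ℝ V]

/-- The action of an element of the Weyl group, as a linear isometry. -/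
def weylIsometry (P : RootPairing ι ℝ V V) [P.IsEuclidean] (w : P.weylGroup) : V ≃ₗᵢ[ℝ] V where
  toFun x := w • x
  invFun x := w⁻¹ • x
  left_inv := inv_smul_smul w
  right_inv := smul_inv_smul w
  map_add' := smul_add w
  map_smul' := P.weylGroup_smul_smul w
  norm_map' := P.norm_weylGroup_smul w

@[simp] lemma weylIsometry_apply (P : RootPairing ι ℝ V V) [P.IsEuclidean] (w : P.weylGroup)
    (x : V) : P.weylIsometry w x = w • x := rfl

lemma det_one_sub_weylLinear_nonneg (P : RootPairing ι ℝ V V) [P.IsEuclidean]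
    [FiniteDimensional ℝ V] (w : P.weylGroup) : 0 ≤ LinearMap.det (1 - P.weylLinear w) :=
  LinearMap.det_one_sub_nonneg_of_norm_map _ (P.norm_weylGroup_smul w)

lemma tile_weylGroup_eq_image {P : RootPairing ι ℝ V V} (b : P.Base) (θ : ι) (w : P.weylGroup) :
    b.tile θ (fun x => w • x) = ⇑(1 - P.weylLinear w) '' b.alcove θ := rfl

namespace Base

variable {P : RootPairing ι ℝ V V} {b : P.Base} {θ : ι}

lemma tile_add_smul (v : V) (w : P.weylGroup) :
    b.tile θ (fun x => v + w • x) = -v +ᵥ b.tile θ (fun x => w • x) := by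
  rw [tile, tile, ← Set.image_vadd, Set.image_image]
  refine Set.image_congr fun x _ => ?_
  rw [vadd_eq_add]
  abel

variable [Finite ι] [FiniteDimensional ℝ V] [P.IsRootSystem]

lemma closure_tile (hθ : b.IsHighestRoot θ) {u : V → V} (hu : Continuous u) :
    closure (b.tile θ u) = (fun x => x - u x) '' b.closedAlcove θ := by
  have hc : Continuous fun x => x - u x := continuous_id.sub hu
  rw [tile, ← closure_alcove nonempty_alcove]
  refine (closure_minimal (Set.image_mono subset_closure) ?_).antisymm
    (image_closure_subset_closure_image hc)
  rw [closure_alcove nonempty_alcove]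
  exact ((isCompact_closedAlcove hθ).image hc).isClosed

variable [P.IsEuclidean]

omit [Finite ι] [P.IsRootSystem] [P.IsEuclidean] in
lemma isOpen_tile {w : P.weylGroup} (hw : LinearMap.det (1 - P.weylLinear w) ≠ 0) :
    IsOpen (b.tile θ (fun x => w • x)) := by
  rw [tile_weylGroup_eq_image]
  exact LinearMap.isOpenMap_of_finiteDimensional _
    ((LinearMap.bijective_iff_det_ne_zero _).2 hw).surjective _ isOpen_alcove

section Measure

open MeasureTheory

variable [MeasurableSpace V] [BorelSpace V]

omit [Finite ι] [P.IsEuclidean] in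
lemma volume_closedAlcove_diff_alcove : volume (b.closedAlcove θ \ b.alcove θ) = 0 := by
  have h := (convex_alcove (b := b) (θ := θ)).addHaar_frontier volume
  rwa [frontier, closure_alcove nonempty_alcove, isOpen_alcove.interior_eq] at h

lemma volume_closure_tile_diff_tile (hθ : b.IsHighestRoot θ) (w : P.weylGroup) :
    volume (closure (b.tile θ fun x => w • x) \ b.tile θ fun x => w • x) = 0 := by
  rw [closure_tile hθ (P.continuous_weylGroup_smul w)]
  refine measure_mono_null (t := ⇑(1 - P.weylLinear w) '' (b.closedAlcove θ \ b.alcove θ))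
    (fun x hx => ?_) ?_
  · obtain ⟨⟨a, ha, rfl⟩, hx⟩ := hx
    exact ⟨a, ⟨ha, fun ha' => hx ⟨a, ha', rfl⟩⟩, rfl⟩
  · rw [Measure.addHaar_image_linearMap, volume_closedAlcove_diff_alcove, mul_zero]

variable [P.IsCrystallographic] [P.IsReduced]

/-- Folding gives the covering outside the null set of walls; simple transitivity on alcoves gives
disjointness. -/
lemma isAddFundamentalDomain_iUnion_smul_alcove (hθ : b.IsHighestRoot θ) :
    IsAddFundamentalDomain P.corootLattice (⋃ w : P.weylGroup, P.weylIsometry w '' b.alcove θ)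
      volume where
  nullMeasurableSet := by
    refine (isOpen_iUnion fun w => ?_).measurableSet.nullMeasurableSet
    exact (P.weylIsometry w).toHomeomorph.isOpenMap _ isOpen_alcove
  ae_covers := by
    have := P.countable_corootLattice
    have := P.finite_weylGroup
    have hnull : volume (⋃ v : P.corootLattice, ⋃ w : P.weylGroup,
        (P.weylIsometry w) ⁻¹' (-(v : V) +ᵥ (b.closedAlcove θ \ b.alcove θ))) = 0 := by
      refine measure_iUnion_null fun v => measure_iUnion_null fun w => ?_
      rw [(P.weylIsometry w).measurePreserving.measure_preimage_emb
        (P.weylIsometry w).toHomeomorph.measurableEmbedding, measure_vadd]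
      exact volume_closedAlcove_diff_alcove
    filter_upwards [compl_mem_ae_iff.2 hnull] with x hx
    obtain ⟨v, hv, w, h⟩ := exists_add_smul_mem_closedAlcove b θ x
    have hA : v + w • x ∈ b.alcove θ := by
      by_contra hcon
      apply hx
      refine Set.mem_iUnion_of_mem ⟨v, hv⟩ (Set.mem_iUnion_of_mem w ?_)
      rw [Set.mem_preimage, Set.mem_vadd_set_iff_neg_vadd_mem]
      simpa using ⟨h, hcon⟩
    refine ⟨⟨w⁻¹ • v, P.weylGroup_smul_mem_corootLattice _ hv⟩,
      Set.mem_iUnion_of_mem w⁻¹ ⟨_, hA, ?_⟩⟩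
    rw [weylIsometry_apply, smul_add, inv_smul_smul]
    rfl
  aedisjoint := by
    intro g g' hne
    refine Disjoint.aedisjoint (Set.disjoint_left.2 ?_)
    rintro _ ⟨y, hy, rfl⟩ ⟨y', hy', h⟩
    obtain ⟨w, a, ha, rfl⟩ := Set.mem_iUnion.1 hy
    obtain ⟨w', a', ha', rfl⟩ := Set.mem_iUnion.1 hy'
    have h' : (g' : V) + w' • a' = g + w • a := h
    have h1 : w'⁻¹ • ((g : V) - g') + (w'⁻¹ * w) • a = a' := by
      rw [mul_smul, ← smul_add, sub_add_eq_add_sub, ← h', add_sub_cancel_left, inv_smul_smul]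
    have h2 := (eq_zero_and_eq_one_of_add_smul_mem_alcove hθ ha
      (P.weylGroup_smul_mem_corootLattice w'⁻¹ (sub_mem g.2 g'.2)) (h1 ▸ ha')).1
    exact hne (Subtype.ext (sub_eq_zero.1 ((smul_eq_zero_iff_eq _).1 h2)))

omit [P.IsRootSystem] in
lemma volume_iUnion_smul_alcove [Fintype P.weylGroup] (hθ : b.IsHighestRoot θ) :
    volume (⋃ w : P.weylGroup, P.weylIsometry w '' b.alcove θ) =
      Fintype.card P.weylGroup * volume (b.alcove θ) := by
  rw [measure_iUnion, tsum_fintype]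
  · have : ∀ w : P.weylGroup, volume (P.weylIsometry w '' b.alcove θ) = volume (b.alcove θ) := by
      intro w
      have h := (P.weylIsometry w).measurePreserving.measure_preimage_emb
        (P.weylIsometry w).toHomeomorph.measurableEmbedding (P.weylIsometry w '' b.alcove θ)
      rw [← h, Set.preimage_image_eq _ (P.weylIsometry w).injective]
    simp [this]
  · intro w w' hne
    refine Set.disjoint_left.2 ?_
    rintro _ ⟨a, ha, rfl⟩ ⟨a', ha', h⟩
    have h1 : (0 : V) + (w'⁻¹ * w) • a = a' := by
      have h' : w' • a' = w • a := h
      rw [zero_add, mul_smul, ← h', inv_smul_smul]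
    have h2 := (eq_zero_and_eq_one_of_add_smul_mem_alcove hθ ha (zero_mem _) (h1 ▸ ha')).2
    exact hne (inv_mul_eq_one.1 h2).symm
  · exact fun w => ((P.weylIsometry w).toHomeomorph.isOpenMap _ isOpen_alcove).measurableSet

/-- The translates of the tiles `V_w` by the co-root lattice are almost everywhere disjoint. -/
lemma volume_vadd_tile_inter_vadd_tile (hθ : b.IsHighestRoot θ) {v v' : V}
    (hv : v ∈ P.corootLattice) (hv' : v' ∈ P.corootLattice) {w w' : P.weylGroup}
    (hne : v ≠ v' ∨ w ≠ w') :
    volume ((v +ᵥ b.tile θ fun x => w • x) ∩ (v' +ᵥ b.tile θ fun x => w' • x)) = 0 := by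
  have := P.countable_corootLattice
  have := P.finite_weylGroup
  have := Fintype.ofFinite P.weylGroup
  have hpq : ((⟨v, hv⟩, w) : P.corootLattice × P.weylGroup) ≠ (⟨v', hv'⟩, w') := by
    intro h
    simp only [Prod.mk.injEq, Subtype.mk.injEq] at h
    tauto
  refine (isAddFundamentalDomain_iUnion_smul_alcove hθ).measure_vadd_inter_vadd_eq_zero
    (T := fun w => b.tile θ fun x => w • x) ?_ ?_ ?_ ?_ hpq
  · intro w
    exact (convex_alcove.linear_image (1 - P.weylLinear w)).nullMeasurableSet volume
  · have hnull : volume (⋃ v : P.corootLattice, ⋃ w : P.weylGroup,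
        (v : V) +ᵥ (closure (b.tile θ fun x => w • x) \ b.tile θ fun x => w • x)) = 0 := by
      refine measure_iUnion_null fun v => measure_iUnion_null fun w => ?_
      rw [measure_vadd]
      exact volume_closure_tile_diff_tile hθ w
    filter_upwards [compl_mem_ae_iff.2 hnull] with x hx
    obtain ⟨a, ha, v, hv, w, rfl⟩ := exists_eq_sub_add_smul hθ x
    refine ⟨⟨-v, neg_mem hv⟩, w, ?_⟩
    by_contra hcon
    apply hx
    refine Set.mem_iUnion_of_mem ⟨-v, neg_mem hv⟩ (Set.mem_iUnion_of_mem w ?_)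
    have h1 : a - (v + w • a) ∈ -v +ᵥ closure (b.tile θ fun x => w • x) := by
      rw [closure_tile hθ (P.continuous_weylGroup_smul w)]
      refine ⟨a - w • a, ⟨a, ha, rfl⟩, ?_⟩
      simp only [vadd_eq_add]
      abel
    rw [Set.vadd_set_sdiff]
    exact ⟨h1, hcon⟩
  -- Nonnegativity removes the absolute values from the volume factors, so the sum of determinants
  -- gives equality with the volume of the domain.
  · rw [volume_iUnion_smul_alcove hθ]
    have h1 : ∀ w : P.weylGroup, volume (b.tile θ fun x => w • x) =
        ENNReal.ofReal (LinearMap.det (1 - P.weylLinear w)) * volume (b.alcove θ) := by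
      intro w
      rw [tile_weylGroup_eq_image, Measure.addHaar_image_linearMap, abs_of_nonneg
        (P.det_one_sub_weylLinear_nonneg w)]
    simp only [h1]
    rw [← Finset.sum_mul, ← ENNReal.ofReal_sum_of_nonneg fun w _ =>
      P.det_one_sub_weylLinear_nonneg w,
      P.sum_det_one_sub_weylLinear, ENNReal.ofReal_natCast]
  · rw [volume_iUnion_smul_alcove hθ]
    refine ENNReal.mul_ne_top (by simp) ?_
    exact ((measure_mono alcove_subset_closedAlcove).trans_lt
      (isCompact_closedAlcove hθ).measure_lt_top).ne

end Measure

end Base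

end RootPairing

/-! ### From null overlaps to the two tilings -/

namespace RootPairing.Base

variable {ι V : Type*} [Finite ι] [NormedAddCommGroup V] [InnerProductSpace ℝ V]
  [FiniteDimensional ℝ V] {P : RootPairing ι ℝ V V} [P.IsRootSystem] [P.IsEuclidean]
  [P.IsCrystallographic] [P.IsReduced] {b : P.Base} {θ : ι}

lemma exists_mem_vadd_closure_tile (hθ : b.IsHighestRoot θ) (x : V) :
    ∃ v ∈ P.corootLattice, ∃ w : P.weylGroup, x ∈ v +ᵥ closure (b.tile θ fun x => w • x) := by
  obtain ⟨a, ha, v, hv, w, rfl⟩ := exists_eq_sub_add_smul hθ x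
  refine ⟨-v, neg_mem hv, w, a - w • a, ?_, ?_⟩
  · rw [closure_tile hθ (P.continuous_weylGroup_smul w)]
    exact ⟨a, ha, rfl⟩
  · simp only [vadd_eq_add]
    abel

omit [FiniteDimensional ℝ V] [P.IsEuclidean] [P.IsCrystallographic] [P.IsReduced] in
lemma closure_weylUnion : closure (b.weylUnion θ) =
    ⋃ w : P.weylGroup, closure (b.tile θ fun x => w • x) := by
  have := P.finite_weylGroup
  rw [weylUnion, closure_iUnion_of_finite]

omit [P.IsCrystallographic] [P.IsReduced] in
lemma isCompact_closure_tile (hθ : b.IsHighestRoot θ) (w : P.weylGroup) :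
    IsCompact (closure (b.tile θ fun x => w • x)) := by
  rw [closure_tile hθ (P.continuous_weylGroup_smul w)]
  exact (isCompact_closedAlcove hθ).image (continuous_id.sub (P.continuous_weylGroup_smul w))

lemma iUnion_vadd_closure_weylUnion (hθ : b.IsHighestRoot θ) :
    ⋃ v ∈ P.corootLattice, (v +ᵥ closure (b.weylUnion θ)) = Set.univ := by
  refine Set.eq_univ_of_forall fun x => ?_
  obtain ⟨v, hv, w, hx⟩ := exists_mem_vadd_closure_tile hθ x
  refine Set.mem_biUnion hv (Set.vadd_set_mono ?_ hx)
  rw [closure_weylUnion]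
  exact Set.subset_iUnion (fun w : P.weylGroup => closure (b.tile θ fun x => w • x)) w

open MeasureTheory in
lemma volume_vadd_closure_tile_inter [MeasurableSpace V] [BorelSpace V]
    (hθ : b.IsHighestRoot θ) {v v' : V} (hv : v ∈ P.corootLattice) (hv' : v' ∈ P.corootLattice)
    {w w' : P.weylGroup} (hne : v ≠ v' ∨ w ≠ w') :
    volume ((v +ᵥ closure (b.tile θ fun x => w • x)) ∩
      (v' +ᵥ closure (b.tile θ fun x => w' • x))) = 0 := by
  have h1 : ∀ (v : V) (w : P.weylGroup), volume (v +ᵥ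
      (closure (b.tile θ fun x => w • x) \ b.tile θ fun x => w • x)) = 0 := fun v w => by
    rw [measure_vadd, volume_closure_tile_diff_tile hθ w]
  refine measure_mono_null ?_ (measure_union_null (measure_union_null (h1 v w) (h1 v' w'))
    (volume_vadd_tile_inter_vadd_tile hθ hv hv' hne))
  rintro x ⟨hx, hx'⟩
  rw [Set.vadd_set_sdiff, Set.vadd_set_sdiff]
  by_cases h : x ∈ v +ᵥ b.tile θ fun x => w • x
  · by_cases h' : x ∈ v' +ᵥ b.tile θ fun x => w' • x
    · exact Or.inr ⟨h, h'⟩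
    · exact Or.inl (Or.inr ⟨hx', h'⟩)
  · exact Or.inl (Or.inl ⟨hx, h⟩)

-- The intersection is open, and finitely many null intersections of closed tiles cover it; a null
-- open set is empty.
open MeasureTheory in
lemma disjoint_vadd_interior_closure_weylUnion (hθ : b.IsHighestRoot θ) {v v' : V}
    (hv : v ∈ P.corootLattice) (hv' : v' ∈ P.corootLattice) (hne : v ≠ v') :
    Disjoint (v +ᵥ interior (closure (b.weylUnion θ)))
      (v' +ᵥ interior (closure (b.weylUnion θ))) := by
  let := borel V
  have : BorelSpace V := ⟨rfl⟩
  have := P.finite_weylGroup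
  rw [Set.disjoint_iff_inter_eq_empty, ← ((isOpen_interior.vadd v).inter
    (isOpen_interior.vadd v')).measure_eq_zero_iff volume]
  have hnull : volume (⋃ w : P.weylGroup, ⋃ w' : P.weylGroup,
      (v +ᵥ closure (b.tile θ fun x => w • x)) ∩
        (v' +ᵥ closure (b.tile θ fun x => w' • x))) = 0 :=
    measure_iUnion_null fun w => measure_iUnion_null fun w' =>
      volume_vadd_closure_tile_inter hθ hv hv' (Or.inl hne)
  refine measure_mono_null ?_ hnull
  refine (Set.inter_subset_inter (Set.vadd_set_mono interior_subset)
    (Set.vadd_set_mono interior_subset)).trans ?_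
  rw [closure_weylUnion, Set.vadd_set_iUnion, Set.vadd_set_iUnion, Set.iUnion_inter_iUnion]

omit [Finite ι] [P.IsRootSystem] [P.IsCrystallographic] [P.IsReduced] in
lemma exists_eq_of_mem_affineWeylReg {g : V ≃ᵃ[ℝ] V} (hg : g ∈ P.affineWeylReg) :
    ∃ v ∈ P.corootLattice, ∃ w : P.weylGroup, (∀ x, g x = v + w • x) ∧
      LinearMap.det (1 - P.weylLinear w) ≠ 0 := by
  obtain ⟨⟨v, hv, w, h⟩, hbij⟩ := hg
  refine ⟨v, hv, w, h, ?_⟩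
  rw [← LinearMap.bijective_iff_det_ne_zero]
  have : ⇑(1 - P.weylLinear w) = (Equiv.addLeft v) ∘ fun x => x - g x := by
    ext x
    simp only [Function.comp_apply, _root_.Equiv.coe_addLeft, h]
    change x - w • x = _
    abel
  rw [this]
  exact (_root_.Equiv.bijective _).comp hbij

omit [Finite ι] [P.IsRootSystem] [P.IsCrystallographic] [P.IsReduced] in
lemma exists_mem_affineWeylReg {v : V} (hv : v ∈ P.corootLattice) {w : P.weylGroup}
    (hw : LinearMap.det (1 - P.weylLinear w) ≠ 0) :
    ∃ g ∈ P.affineWeylReg, ∀ x, g x = v + w • x := by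
  let g : V ≃ᵃ[ℝ] V :=
    (P.weylIsometry w).toLinearEquiv.toAffineEquiv.trans (AffineEquiv.constVAdd ℝ V v)
  have hg : ∀ x, g x = v + w • x := fun x => rfl
  refine ⟨g, ⟨⟨v, hv, w, hg⟩, ?_⟩, hg⟩
  rw [← LinearMap.bijective_iff_det_ne_zero] at hw
  have : (fun x => x - g x) = (_root_.Equiv.addLeft (-v)) ∘ ⇑(1 - P.weylLinear w) := by
    ext x
    simp only [Function.comp_apply, _root_.Equiv.coe_addLeft, hg]
    change _ = -v + (x - w • x)
    abel
  rw [this]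
  exact (_root_.Equiv.bijective _).comp hw

open MeasureTheory in
lemma disjoint_tile_of_mem_affineWeylReg (hθ : b.IsHighestRoot θ) {g g' : V ≃ᵃ[ℝ] V}
    (hg : g ∈ P.affineWeylReg) (hg' : g' ∈ P.affineWeylReg) (hne : g ≠ g') :
    Disjoint (b.tile θ g) (b.tile θ g') := by
  let := borel V
  have : BorelSpace V := ⟨rfl⟩
  obtain ⟨v, hv, w, h, hw⟩ := exists_eq_of_mem_affineWeylReg hg
  obtain ⟨v', hv', w', h', hw'⟩ := exists_eq_of_mem_affineWeylReg hg'
  rw [funext h, funext h', tile_add_smul, tile_add_smul, Set.disjoint_iff_inter_eq_empty,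
    ← (((isOpen_tile hw).vadd (-v)).inter ((isOpen_tile hw').vadd (-v'))).measure_eq_zero_iff
      volume]
  apply volume_vadd_tile_inter_vadd_tile hθ (neg_mem hv) (neg_mem hv')
  by_contra! hcon
  apply hne
  ext x
  rw [h, h', neg_injective hcon.1, hcon.2]

-- By discreteness of the lattice only finitely many translates of the bounded set `K` meet a given
-- ball.
omit [FiniteDimensional ℝ V] [P.IsReduced] in
lemma isClosed_iUnion_vadd_of_isCompact {K : Set V} (hK : IsCompact K) :
    IsClosed (⋃ v : P.corootLattice, (v : V) +ᵥ K) := by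
  refine LocallyFinite.isClosed_iUnion (fun x => ?_) fun v => hK.isClosed.vadd (v : V)
  obtain ⟨R, hR⟩ := hK.isBounded.exists_norm_le
  refine ⟨Metric.ball x 1, Metric.ball_mem_nhds x one_pos, ?_⟩
  refine Set.Finite.of_finite_image ((P.finite_corootLattice_inter_norm_le
    (‖x‖ + 1 + R)).subset ?_) Subtype.val_injective.injOn
  rintro _ ⟨v, ⟨_, ⟨y, hy, rfl⟩, hvy⟩, rfl⟩
  refine ⟨v.2, ?_⟩
  have h1 : ‖(v : V) + y - x‖ < 1 := by
    rw [← dist_eq_norm]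
    exact hvy
  calc ‖(v : V)‖ = ‖((v : V) + y - x) + x - y‖ := by congr 1; abel
    _ ≤ ‖((v : V) + y - x) + x‖ + ‖y‖ := norm_sub_le _ _
    _ ≤ ‖(v : V) + y - x‖ + ‖x‖ + ‖y‖ := by gcongr; exact norm_add_le _ _
    _ ≤ 1 + ‖x‖ + R := by gcongr; exact hR y hy
    _ = ‖x‖ + 1 + R := by ring

-- What the regular closed tiles miss is covered by the singular ones, which are null. It is also
-- open, hence empty.
open MeasureTheory in
lemma iUnion_closure_tile_affineWeylReg (hθ : b.IsHighestRoot θ) :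
    ⋃ g ∈ P.affineWeylReg, closure (b.tile θ g) = Set.univ := by
  let := borel V
  have : BorelSpace V := ⟨rfl⟩
  have := P.finite_weylGroup
  have := P.countable_corootLattice
  set K : Set V := ⋃ w ∈ {w : P.weylGroup | LinearMap.det (1 - P.weylLinear w) ≠ 0},
    closure (b.tile θ fun x => w • x) with hKdef
  have hK : IsCompact K := (Set.toFinite _).isCompact_biUnion fun w _ => isCompact_closure_tile hθ w
  have hsub : ⋃ v : P.corootLattice, (v : V) +ᵥ K ⊆
      ⋃ g ∈ P.affineWeylReg, closure (b.tile θ g) := by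
    refine Set.iUnion_subset fun v => ?_
    rw [hKdef, Set.vadd_set_iUnion₂]
    refine Set.iUnion₂_subset fun w hw => ?_
    obtain ⟨g, hg, h⟩ := exists_mem_affineWeylReg (neg_mem v.2) hw
    refine subset_trans ?_ (Set.subset_biUnion_of_mem hg)
    rw [funext h, tile_add_smul, neg_neg, closure_vadd]
  refine Set.eq_univ_of_univ_subset (subset_trans ?_ hsub)
  have hopen : IsOpen (⋃ v : P.corootLattice, (v : V) +ᵥ K)ᶜ :=
    (isClosed_iUnion_vadd_of_isCompact hK).isOpen_compl
  rw [Set.univ_subset_iff, ← Set.compl_empty_iff, ← hopen.measure_eq_zero_iff volume]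
  have hnull : volume (⋃ v : P.corootLattice, ⋃ w : P.weylGroup, ⋃ _ :
      LinearMap.det (1 - P.weylLinear w) = 0, (v : V) +ᵥ closure (b.tile θ fun x => w • x)) = 0 := by
    refine measure_iUnion_null fun v => measure_iUnion_null fun w => measure_iUnion_null fun hw => ?_
    rw [measure_vadd, ← Set.sdiff_union_inter (closure _) (b.tile θ fun x => w • x)]
    refine measure_union_null (volume_closure_tile_diff_tile hθ w)
      (measure_mono_null Set.inter_subset_right ?_)
    rw [tile_weylGroup_eq_image, Measure.addHaar_image_linearMap, hw]
    simp
  refine measure_mono_null (fun x hx => ?_) hnull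
  obtain ⟨v, hv, w, h⟩ := exists_mem_vadd_closure_tile hθ x
  refine Set.mem_iUnion_of_mem ⟨v, hv⟩ (Set.mem_iUnion_of_mem w (Set.mem_iUnion_of_mem ?_ h))
  by_contra hw
  exact hx (Set.mem_iUnion_of_mem ⟨v, hv⟩
    (Set.vadd_set_mono (Set.subset_biUnion_of_mem (u := fun w : P.weylGroup =>
      closure (b.tile θ fun x => w • x)) hw) h))

end RootPairing.Base

end

theorem proposition3p3 {ι V : Type*} [Finite ι]
    [NormedAddCommGroup V] [InnerProductSpace ℝ V] [FiniteDimensional ℝ V]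
    (P : RootPairing ι ℝ V V) [P.IsRootSystem] [P.IsEuclidean]
    [P.IsCrystallographic] [P.IsReduced] [P.IsIrreducible]
    (b : P.Base) (θ : ι) (hθ : b.IsHighestRoot θ) :
    ((∀ v ∈ P.corootLattice, ∀ v' ∈ P.corootLattice, v ≠ v' →
          Disjoint (v +ᵥ interior (closure (b.weylUnion θ)))
            (v' +ᵥ interior (closure (b.weylUnion θ)))) ∧
        (⋃ v ∈ P.corootLattice, (v +ᵥ closure (b.weylUnion θ))) = Set.univ) ∧
      ((∀ w ∈ P.affineWeylReg, ∀ w' ∈ P.affineWeylReg, w ≠ w' →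
          Disjoint (b.tile θ w) (b.tile θ w')) ∧
        (⋃ w ∈ P.affineWeylReg, closure (b.tile θ w)) = Set.univ) := by
  exact ⟨⟨fun v hv v' hv' hne =>
        RootPairing.Base.disjoint_vadd_interior_closure_weylUnion hθ hv hv' hne,
      RootPairing.Base.iUnion_vadd_closure_weylUnion hθ⟩,
    fun w hw w' hw' hne => RootPairing.Base.disjoint_tile_of_mem_affineWeylReg hθ hw hw' hne,
    RootPairing.Base.iUnion_closure_tile_affineWeylReg hθ⟩
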